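/- For $N\ge 1$ let $\mathcal H_N\subset \mathrm{SL}(2,\mathbb R)^N$ be the hyperbolicity locus of the full $N$-shift: $(A_1,\dots,A_N)\in\mathcal H_N$ iff the cocycle $A^n(x)=A_{x_{n-1}}\cdots A_{x_0}$, $A^{-n}(x)=A_{x_{-n}}^{-1}\cdots A_{x_{-1}}^{-1}$ ($n\ge 0$) over the shift $\sigma$ on $\{1,\dots,N\}^{\mathbb Z}$ is uniformly hyperbolic, i.e. there are a continuous splitting $\mathbb R^2=E^s(x)\oplus E^u(x)$ with $A_{x_0}E^{s}(x)=E^{s}(\sigma x)$, $A_{x_0}E^{u}(x)=E^{u}(\sigma x)$, and constants $K>0$, $0<\lambda<1$ such that $\|A^n(x)v\|\le K\lambda^n\|v\|$ for $v\in E^s(x)$ and $\|A^{-n}(x)v\|\le K\lambda^n\|v\|$ for $v\in E^u(x)$, for all $x$ and all $n\ge0$. A hyperbolic component is a connected component of $\mathcal H_N$. The elliptic locus $\mathcal E\subset \mathrm{SL}(2,\mathbb R)^3$ is the set of triples having a product $M$ (of the three matrices, with repetitions, in any order) with $|\operatorname{tr} M|<2$. For a hyperbolic matrix $M$ (that is,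 $|\operatorname{tr}M|>2$), let $u_M,s_M\in\mathbb P^1$ be its unstable and stable directions: the eigendirections whose eigenvalue has modulus $>1$, respectively $<1$. Let $H_{\mathrm{id}}^+$ be the positive free component of the full $2$-shift: the pairs $(A,B)\in\mathrm{SL}(2,\mathbb R)^2$ with $\operatorname{tr}A>2$, $\operatorname{tr}B>2$, $\operatorname{tr}AB<-2$ and $$u_B<u_{BA}<s_{BA}<s_A<u_A<u_{AB}<s_{AB}<s_B<u_B$$ in the counterclockwise cyclic order on $\mathbb P^1$. Let $H\subset\mathrm{SL}(2,\mathbb R)^3$ be the hyperbolic component of the full $3$-shift that contains triples $(A,B,-AB)$ with $(A,B)\in H_{\mathrm{id}}^+$. **Proposition.** There exist $A,B\in\mathrm{SL}(2,\mathbb R)$ and a smooth path $t\in\mathbb R\mapsto C(t)\in \mathrm{SL}(2,\mathbb R)$ with the following properties: 1. $(A,B,C(t))\in H$ for every $t<0$. 2. At $t=0$ the heteroclinic connection $C(0)\cdot u_B=s_A$ occurs (with $A$ and $B$ hyperbolic), and $(A,B,C(0))\in\partial H$. 3. There exist pairwise distinct hyperbolic components $H_i$ $(i\in\mathbb N)$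 of the full $3$-shift and numbers $t_i>0$ with $t_i\to0$ such that $(A,B,C(t_i))\in H_i$ for all $i$. 4. There exist numbers $s_i>0$ with $s_i\to0$ such that $(A,B,C(s_i))\in\mathcal E$ for all $i$. In particular, every neighborhood of the boundary point $(A,B,C(0))$ of $H$ in $\mathrm{SL}(2,\mathbb R)^3$ meets infinitely many hyperbolic components. -/

import Mathlib

open Matrix Filter Topology
open scoped MatrixGroups ContDiff

/-- The product of the matrices read along the forward orbit of `x` under the shift:
`A^n(x) = A_{x_{n-1}} ⋯ A_{x_1} A_{x_0}`, for `n ≥ 0`. -/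
def forwardProduct {N : ℕ} (A : Fin N → SL(2, ℝ)) (x : ℤ → Fin N) : ℕ → SL(2, ℝ)
  | 0 => 1
  | n + 1 => A (x (n : ℤ)) * forwardProduct A x n

/-- The product of the inverse matrices read along the backward orbit of `x` under the shift:
`A^{-n}(x) = (A_{x_{-n}})⁻¹ ⋯ (A_{x_{-2}})⁻¹ (A_{x_{-1}})⁻¹`, for `n ≥ 0`. -/
def backwardProduct {N : ℕ} (A : Fin N → SL(2, ℝ)) (x : ℤ → Fin N) : ℕ → SL(2, ℝ)
  | 0 => 1
  | n + 1 => (A (x (-((n : ℤ) + 1))))⁻¹ * backwardProduct A x n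

/-- Uniform hyperbolicity of an `N`-tuple over the full shift `(Fin N)^ℤ` (with the product of
the discrete topologies): there is a continuous invariant splitting `ℝ² = Eˢ(x) ⊕ Eᵘ(x)`,
with `Eˢ` uniformly exponentially contracted by the forward iterates of the cocycle and `Eᵘ`
uniformly exponentially contracted by the backward iterates.

The continuous splitting is recorded by the continuous family of idempotent matrices `P x`,
the projection onto `Eˢ(x) = range (P x)` along `Eᵘ(x) = ker (P x) = range (1 - P x)`; the
identity `A_{x_0} P(x) = P(σ x) A_{x_0}`, where `(σ x)_n = x_{n+1}`, is the invariance of both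
subbundles. -/
def UniformlyHyperbolic {N : ℕ} (A : Fin N → SL(2, ℝ)) : Prop :=
  ∃ P : (ℤ → Fin N) → Matrix (Fin 2) (Fin 2) ℝ,
    Continuous P ∧
    (∀ x, P x * P x = P x) ∧
    (∀ x, (A (x 0) : Matrix (Fin 2) (Fin 2) ℝ) * P x
      = P (fun n => x (n + 1)) * (A (x 0) : Matrix (Fin 2) (Fin 2) ℝ)) ∧
    ∃ K l : ℝ, 0 < K ∧ 0 < l ∧ l < 1 ∧
      (∀ x (n : ℕ) (v : Fin 2 → ℝ), P x *ᵥ v = v →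
        ‖(forwardProduct A x n : Matrix (Fin 2) (Fin 2) ℝ) *ᵥ v‖ ≤ K * l ^ n * ‖v‖) ∧
      (∀ x (n : ℕ) (v : Fin 2 → ℝ), P x *ᵥ v = 0 →
        ‖(backwardProduct A x n : Matrix (Fin 2) (Fin 2) ℝ) *ᵥ v‖ ≤ K * l ^ n * ‖v‖)

/-- The hyperbolicity locus of the full `N`-shift, a subset of `SL(2, ℝ)^N`. -/
def hyperbolicLocus (N : ℕ) : Set (Fin N → SL(2, ℝ)) :=
  {A | UniformlyHyperbolic A}

/-- The hyperbolic components: the connected components of the hyperbolicity locus. -/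
def IsHyperbolicComponent {N : ℕ} (H : Set (Fin N → SL(2, ℝ))) : Prop :=
  ∃ A ∈ hyperbolicLocus N, H = connectedComponentIn (hyperbolicLocus N) A

/-- The elliptic locus of the full `N`-shift: some product `M` of the given matrices is elliptic,
that is, `|tr M| < 2`. (The empty product has trace `2`.) -/
def ellipticLocus (N : ℕ) : Set (Fin N → SL(2, ℝ)) :=
  {A | ∃ w : List (Fin N),
    |Matrix.trace ((w.map A).prod : Matrix (Fin 2) (Fin 2) ℝ)| < 2}

/-- The nonzero vector `v` spans the unstable direction `u_M`: it is an eigenvector whose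
eigenvalue has modulus greater than one. Such a `v` exists iff `M` is hyperbolic, and is then
unique up to a scalar. -/
def SpansUnstable (M : SL(2, ℝ)) (v : Fin 2 → ℝ) : Prop :=
  v ≠ 0 ∧ ∃ μ : ℝ, 1 < |μ| ∧ (M : Matrix (Fin 2) (Fin 2) ℝ) *ᵥ v = μ • v

/-- The nonzero vector `v` spans the stable direction `s_M`: it is an eigenvector whose
eigenvalue has modulus less than one. -/
def SpansStable (M : SL(2, ℝ)) (v : Fin 2 → ℝ) : Prop :=
  v ≠ 0 ∧ ∃ μ : ℝ, |μ| < 1 ∧ (M : Matrix (Fin 2) (Fin 2) ℝ) *ᵥ v = μ • v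

/-- The determinant of the pair of plane vectors `(v, w)`. -/
def planeDet (v w : Fin 2 → ℝ) : ℝ := v 0 * w 1 - v 1 * w 0

/-- The lines spanned by the nonzero vectors `d 0, …, d (n-1)` are pairwise distinct (if `n ≥ 3`)
and are met in this cyclic order when the projective line is run through counterclockwise. The
sign of the product below does not change when a vector is multiplied by a nonzero scalar; for
three lines at angles `0 ≤ a, b, c < π` it is positive iff `a < b < c`, `b < c < a` or
`c < a < b`. -/
def CyclicallyOrdered {n : ℕ} (d : Fin n → Fin 2 → ℝ) : Prop :=
  ∀ i j k : Fin n, i < j → j < k →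
    0 < planeDet (d i) (d j) * planeDet (d j) (d k) * planeDet (d i) (d k)

/-- `(A, B)` is in the positive free component of the full `2`-shift: `tr A > 2`, `tr B > 2`,
`tr AB < -2`, and, counterclockwise on the projective line,
`u_B < u_{BA} < s_{BA} < s_A < u_A < u_{AB} < s_{AB} < s_B < u_B`. -/
def InPositiveFreeComponent (A B : SL(2, ℝ)) : Prop :=
  2 < Matrix.trace (A : Matrix (Fin 2) (Fin 2) ℝ) ∧
  2 < Matrix.trace (B : Matrix (Fin 2) (Fin 2) ℝ) ∧
  Matrix.trace ((A * B : SL(2, ℝ)) : Matrix (Fin 2) (Fin 2) ℝ) < -2 ∧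
  ∃ uB uBA sBA sA uA uAB sAB sB : Fin 2 → ℝ,
    SpansUnstable B uB ∧ SpansUnstable (B * A) uBA ∧ SpansStable (B * A) sBA ∧
    SpansStable A sA ∧ SpansUnstable A uA ∧ SpansUnstable (A * B) uAB ∧
    SpansStable (A * B) sAB ∧ SpansStable B sB ∧
    CyclicallyOrdered ![uB, uBA, sBA, sA, uA, uAB, sAB, sB]

/-- The heteroclinic connection `C u_B = s_A`, with `A` and `B` hyperbolic. -/
def HeteroclinicConnection (A B C : SL(2, ℝ)) : Prop :=
  ∃ v : Fin 2 → ℝ, SpansUnstable B v ∧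
    SpansStable A ((C : Matrix (Fin 2) (Fin 2) ℝ) *ᵥ v)

/-! The theorem rests on one explicit family with an exact self-similarity. Let A = diag(1/7, 7),
let B have eigenvalues 7 and 1/7 on u_B = (15, -7) and s_B = (-7, 15), and let C(t) send X u_B + Y
s_B to (16 X, 11 (Y - t X)), so that C(0) u_B lies on s_A. Since A multiplies slopes by 49 and B
divides Y / X by 49, A C(t) B = C(49 t), hence Aⁿ C(t) Bⁿ = C(49ⁿ t). The trace of C(t) is affine
and decreasing in t, with zero 405/77. The parameters 405/77 · 49⁻ⁿ therefore give elliptic triples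
accumulating at 0.

The parameters 49⁻ⁿ/4 give hyperbolic triples (`uniformlyHyperbolic_matC`). They lie in different
components: on the hyperbolic locus every product has |tr| ≥ 2
(`two_le_abs_trace_of_mem_hyperbolicLocus`), so the sign of a trace is constant on a component
(`trace_word_pos_of_mem_component`), while tr Aⁿ C Bⁿ is positive at 49⁻ⁿ/4 and negative at 49⁻ᵐ/4
for m < n.

Hyperbolicity is always proved with finitely many cones permuted by an automaton
(`uniformlyHyperbolic_of_cones`). A cone carries the quadratic form given by the product of the two
coordinates, which no determinant-one cone map decreases. Maps into the interior increase it by a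
definite factor, and a map that only respects the closed cones is allowed if the state number goes
up, which can happen only boundedly often in succession. This gives uniform expansion of one vector,
and `uniformlyHyperbolic_of_expands` builds the splitting from it.

For t < 0 two cones, around u_A and u_B, suffice. The criterion involves C only through its mapping
one fixed cone into the interior of another; such C form a connected set
(`isPreconnected_mapsConeInside`) containing both -AB and C(t), so the path stays in H. The point t
= 0 is a limit of these triples and of elliptic ones, hence on the boundary of H. -/

/-! ### Plane vectors: determinant, norm, rotation. -/

/-- The squared Euclidean norm of a plane vector. -/
def sqNorm (v : Fin 2 → ℝ) : ℝ := v 0 ^ 2 + v 1 ^ 2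

/-- The Euclidean inner product of two plane vectors. -/
def planeDot (v w : Fin 2 → ℝ) : ℝ := v 0 * w 0 + v 1 * w 1

/-- The rotation of a plane vector by a right angle. -/
def rotate (v : Fin 2 → ℝ) : Fin 2 → ℝ := ![-v 1, v 0]

lemma mulVec_zero_apply (M : Matrix (Fin 2) (Fin 2) ℝ) (v : Fin 2 → ℝ) :
    (M *ᵥ v) 0 = M 0 0 * v 0 + M 0 1 * v 1 := by
  simp [mulVec, dotProduct, Fin.sum_univ_two]

lemma mulVec_one_apply (M : Matrix (Fin 2) (Fin 2) ℝ) (v : Fin 2 → ℝ) :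
    (M *ᵥ v) 1 = M 1 0 * v 0 + M 1 1 * v 1 := by
  simp [mulVec, dotProduct, Fin.sum_univ_two]

lemma sl_det_entries (M : SL(2, ℝ)) : M 0 0 * M 1 1 - M 0 1 * M 1 0 = 1 := by
  have := M.det_coe
  rwa [Matrix.det_fin_two] at this

lemma planeDet_mulVec (M : SL(2, ℝ)) (v w : Fin 2 → ℝ) :
    planeDet ((M : Matrix (Fin 2) (Fin 2) ℝ) *ᵥ v) ((M : Matrix (Fin 2) (Fin 2) ℝ) *ᵥ w)
      = planeDet v w := by
  have h := sl_det_entries M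
  simp only [planeDet, mulVec_zero_apply, mulVec_one_apply]
  linear_combination (v 0 * w 1 - v 1 * w 0) * h

lemma planeDet_self (v : Fin 2 → ℝ) : planeDet v v = 0 := by
  simp only [planeDet]; ring

lemma planeDet_add_right (u v w : Fin 2 → ℝ) :
    planeDet u (v + w) = planeDet u v + planeDet u w := by
  simp only [planeDet, Pi.add_apply]; ring

lemma planeDet_add_left (u v w : Fin 2 → ℝ) :
    planeDet (u + v) w = planeDet u w + planeDet v w := by
  simp only [planeDet, Pi.add_apply]; ring

lemma planeDet_smul_right (c : ℝ) (v w : Fin 2 → ℝ) :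
    planeDet v (c • w) = c * planeDet v w := by
  simp only [planeDet, Pi.smul_apply, smul_eq_mul]; ring

lemma planeDet_smul_left (c : ℝ) (v w : Fin 2 → ℝ) :
    planeDet (c • v) w = c * planeDet v w := by
  simp only [planeDet, Pi.smul_apply, smul_eq_mul]; ring

lemma plane_expansion {v w : Fin 2 → ℝ} (h : planeDet v w = 1) (z : Fin 2 → ℝ) :
    z = planeDet z w • v + planeDet v z • w := by
  simp only [planeDet] at h
  ext i
  fin_cases i <;> simp [planeDet]
  · linear_combination (-z 0) * h
  · linear_combination (-z 1) * h

lemma sqNorm_nonneg (v : Fin 2 → ℝ) : 0 ≤ sqNorm v := by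
  simp only [sqNorm]; positivity

lemma sqNorm_pos {v : Fin 2 → ℝ} (hv : v ≠ 0) : 0 < sqNorm v := by
  refine lt_of_le_of_ne (sqNorm_nonneg _) fun h => hv ?_
  simp only [sqNorm] at h
  have h0 : v 0 = 0 := by nlinarith [sq_nonneg (v 0), sq_nonneg (v 1)]
  have h1 : v 1 = 0 := by nlinarith [sq_nonneg (v 0), sq_nonneg (v 1)]
  ext i; fin_cases i <;> simp [h0, h1]

lemma sqNorm_smul (c : ℝ) (v : Fin 2 → ℝ) : sqNorm (c • v) = c ^ 2 * sqNorm v := by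
  simp only [sqNorm, Pi.smul_apply, smul_eq_mul]; ring

lemma sqNorm_add_le (v w : Fin 2 → ℝ) : sqNorm (v + w) ≤ 2 * (sqNorm v + sqNorm w) := by
  simp only [sqNorm, Pi.add_apply]
  nlinarith [sq_nonneg (v 0 - w 0), sq_nonneg (v 1 - w 1)]

lemma sqNorm_rotate (v : Fin 2 → ℝ) : sqNorm (rotate v) = sqNorm v := by
  simp only [sqNorm, rotate]; simp; ring

lemma planeDet_sq_le (v w : Fin 2 → ℝ) : planeDet v w ^ 2 ≤ sqNorm v * sqNorm w := by
  simp only [sqNorm, planeDet]; nlinarith [sq_nonneg (v 0 * w 0 + v 1 * w 1)]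

lemma planeDot_sq_le (v w : Fin 2 → ℝ) : planeDot v w ^ 2 ≤ sqNorm v * sqNorm w := by
  simp only [sqNorm, planeDot]; nlinarith [sq_nonneg (v 0 * w 1 - v 1 * w 0)]

lemma norm_sq_le_sqNorm (v : Fin 2 → ℝ) : ‖v‖ ^ 2 ≤ sqNorm v := by
  have h : ‖v‖ ≤ Real.sqrt (sqNorm v) := by
    rw [pi_norm_le_iff_of_nonneg (Real.sqrt_nonneg _)]
    intro i
    apply Real.le_sqrt_of_sq_le
    rw [Real.norm_eq_abs, sq_abs]
    fin_cases i <;> simp only [sqNorm] <;> simp <;> positivity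
  calc ‖v‖ ^ 2 ≤ Real.sqrt (sqNorm v) ^ 2 := by gcongr
    _ = _ := Real.sq_sqrt (sqNorm_nonneg v)

lemma sqNorm_le_norm_sq (v : Fin 2 → ℝ) : sqNorm v ≤ 2 * ‖v‖ ^ 2 := by
  have h : ∀ i, v i ^ 2 ≤ ‖v‖ ^ 2 := fun i => by
    rw [← sq_abs (v i)]
    have := norm_le_pi_norm v i
    rw [Real.norm_eq_abs] at this
    gcongr
  simp only [sqNorm]
  linarith [h 0, h 1]

lemma exists_sqNorm_mulVec_le {N : ℕ} (A : Fin N → SL(2, ℝ)) :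
    ∃ K : ℝ, 1 ≤ K ∧ ∀ i v,
      sqNorm ((A i : Matrix (Fin 2) (Fin 2) ℝ) *ᵥ v) ≤ K ^ 2 * sqNorm v := by
  have hF : ∀ i, 0 ≤ sqNorm (A i 0) + sqNorm (A i 1) := fun i =>
    add_nonneg (sqNorm_nonneg _) (sqNorm_nonneg _)
  refine ⟨1 + ∑ i, (sqNorm (A i 0) + sqNorm (A i 1)),
    le_add_of_nonneg_right (Finset.sum_nonneg fun i _ => hF i), fun i v => ?_⟩
  have h1 := Finset.single_le_sum (f := fun i => sqNorm (A i 0) + sqNorm (A i 1))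
    (fun i _ => hF i) (Finset.mem_univ i)
  set S := ∑ i, (sqNorm (A i 0) + sqNorm (A i 1))
  have h2 : sqNorm ((A i : Matrix (Fin 2) (Fin 2) ℝ) *ᵥ v)
      ≤ (sqNorm (A i 0) + sqNorm (A i 1)) * sqNorm v := by
    have e0 := planeDot_sq_le (A i 0) v
    have e1 := planeDot_sq_le (A i 1) v
    simp only [planeDot] at e0 e1
    have : sqNorm ((A i : Matrix (Fin 2) (Fin 2) ℝ) *ᵥ v)
      = (A i 0 0 * v 0 + A i 0 1 * v 1) ^ 2 + (A i 1 0 * v 0 + A i 1 1 * v 1) ^ 2 := by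
      rw [sqNorm, mulVec_zero_apply, mulVec_one_apply]
    rw [this]; linarith
  have h3 : 0 ≤ S := (hF i).trans h1
  refine h2.trans (mul_le_mul_of_nonneg_right ?_ (sqNorm_nonneg v))
  nlinarith [h1]

/-! ### The shift -/

/-- The `m`-th power of the shift. -/
def shiftBy {N : ℕ} (m : ℤ) (x : ℤ → Fin N) : ℤ → Fin N := fun n => x (n + m)

lemma shiftBy_shiftBy {N : ℕ} (m k : ℤ) (x : ℤ → Fin N) :
    shiftBy m (shiftBy k x) = shiftBy (m + k) x := by
  funext n; simp [shiftBy, add_assoc]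

lemma shiftBy_zero {N : ℕ} (x : ℤ → Fin N) : shiftBy 0 x = x := by
  funext n; simp [shiftBy]

lemma continuous_shiftBy {N : ℕ} (m : ℤ) : Continuous (shiftBy (N := N) m) :=
  continuous_pi fun n => continuous_apply (n + m)

lemma forwardProduct_shift {N : ℕ} (A : Fin N → SL(2, ℝ)) (x : ℤ → Fin N) (n : ℕ) :
    forwardProduct A (shiftBy 1 x) n * A (x 0) = forwardProduct A x (n + 1) := by
  induction n with
  | zero => simp [forwardProduct]
  | succ n ih =>
    rw [forwardProduct, mul_assoc, ih]
    simp [forwardProduct, shiftBy]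

lemma forwardProduct_mulVec_succ {N : ℕ} (A : Fin N → SL(2, ℝ)) (x : ℤ → Fin N) (n : ℕ)
    (v : Fin 2 → ℝ) : (forwardProduct A x (n + 1) : Matrix (Fin 2) (Fin 2) ℝ) *ᵥ v
      = (A (x n) : Matrix (Fin 2) (Fin 2) ℝ) *ᵥ
        ((forwardProduct A x n : Matrix (Fin 2) (Fin 2) ℝ) *ᵥ v) := by
  rw [mulVec_mulVec]
  exact congrArg (· *ᵥ v) (Matrix.SpecialLinearGroup.coe_mul (A (x n)) (forwardProduct A x n))

lemma forwardProduct_zero_mulVec {N : ℕ} (A : Fin N → SL(2, ℝ)) (x : ℤ → Fin N)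
    (v : Fin 2 → ℝ) : (forwardProduct A x 0 : Matrix (Fin 2) (Fin 2) ℝ) *ᵥ v = v :=
  one_mulVec v

lemma continuous_letter {N : ℕ} (A : Fin N → SL(2, ℝ)) (m : ℤ) :
    Continuous fun x : ℤ → Fin N => (A (x m) : Matrix (Fin 2) (Fin 2) ℝ) :=
  (continuous_of_discreteTopology
    (f := fun i : Fin N => (A i : Matrix (Fin 2) (Fin 2) ℝ))).comp (continuous_apply m)

lemma continuous_forwardProduct_mulVec {N : ℕ} (A : Fin N → SL(2, ℝ)) (v : Fin 2 → ℝ) (n : ℕ) :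
    Continuous fun x : ℤ → Fin N =>
      (forwardProduct A x n : Matrix (Fin 2) (Fin 2) ℝ) *ᵥ v := by
  induction n with
  | zero => simpa [forwardProduct] using continuous_const
  | succ n ih =>
    simp_rw [forwardProduct_mulVec_succ]
    exact (continuous_letter A n).matrix_mulVec ih

lemma Continuous.planeDet {X : Type*} [TopologicalSpace X] {f g : X → Fin 2 → ℝ}
    (hf : Continuous f) (hg : Continuous g) : Continuous fun x => _root_.planeDet (f x) (g x) := by
  unfold _root_.planeDet; fun_prop

lemma Continuous.sqNorm {X : Type*} [TopologicalSpace X] {f : X → Fin 2 → ℝ}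
    (hf : Continuous f) : Continuous fun x => _root_.sqNorm (f x) := by
  unfold _root_.sqNorm; fun_prop

lemma Continuous.planeDot {X : Type*} [TopologicalSpace X] {f g : X → Fin 2 → ℝ}
    (hf : Continuous f) (hg : Continuous g) : Continuous fun x => _root_.planeDot (f x) (g x) := by
  unfold _root_.planeDot; fun_prop

/-! ### From uniform expansion of one vector to a hyperbolic splitting. -/

/-- A stable section: if all forward products expand a fixed vector `v₀` uniformly exponentially,
then a continuous family of vectors `e x`, normalized by `planeDet v₀ (e x) = 1`, is contracted. -/
lemma exists_stable_section {N : ℕ} (A : Fin N → SL(2, ℝ)) (v₀ : Fin 2 → ℝ) (hv₀ : v₀ ≠ 0)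
    {c θ : ℝ} (hc : 0 < c) (hθ : 1 < θ)
    (hgrow : ∀ x (n k : ℕ),
      c * θ ^ (2 * k) * sqNorm ((forwardProduct A x n : Matrix (Fin 2) (Fin 2) ℝ) *ᵥ v₀)
        ≤ sqNorm ((forwardProduct A x (n + k) : Matrix (Fin 2) (Fin 2) ℝ) *ᵥ v₀)) :
    ∃ (e : (ℤ → Fin N) → Fin 2 → ℝ) (C : ℝ), 0 < C ∧ Continuous e ∧
      (∀ x, planeDet v₀ (e x) = 1) ∧
      ∀ x (n : ℕ), sqNorm ((forwardProduct A x n : Matrix (Fin 2) (Fin 2) ℝ) *ᵥ e x)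
        ≤ C / θ ^ (2 * n) := by
  obtain ⟨K, hK, hKA⟩ := exists_sqNorm_mulVec_le A
  have hN0 : 0 < sqNorm v₀ := sqNorm_pos hv₀
  set w₀ : Fin 2 → ℝ := (sqNorm v₀)⁻¹ • rotate v₀ with hw₀
  set f : (ℤ → Fin N) → ℕ → Fin 2 → ℝ :=
    fun x n => (forwardProduct A x n : Matrix (Fin 2) (Fin 2) ℝ) *ᵥ v₀ with hf
  set g : (ℤ → Fin N) → ℕ → Fin 2 → ℝ :=
    fun x n => (forwardProduct A x n : Matrix (Fin 2) (Fin 2) ℝ) *ᵥ w₀ with hg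
  have hdet0 : planeDet v₀ w₀ = 1 := by
    rw [hw₀, planeDet_smul_right, inv_mul_eq_one₀ hN0.ne']
    simp [planeDet, rotate, sqNorm]; ring
  have hdet : ∀ x n, planeDet (f x n) (g x n) = 1 := fun x n => by
    simp only [hf, hg]; rw [planeDet_mulVec, hdet0]
  have hf0 : ∀ x, f x 0 = v₀ := fun x => forwardProduct_zero_mulVec A x v₀
  have hg0 : ∀ x, g x 0 = w₀ := fun x => forwardProduct_zero_mulVec A x w₀
  have hθ0 : 0 < θ := by linarith
  have hNlow : ∀ x n, c * θ ^ (2 * n) * sqNorm v₀ ≤ sqNorm (f x n) := fun x n => by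
    have := hgrow x 0 n
    simpa [forwardProduct, hf] using this
  have hNpos : ∀ x n, 0 < sqNorm (f x n) := fun x n =>
    lt_of_lt_of_le (by positivity) (hNlow x n)
  -- the slope of the vector that is best contracted after `n` steps
  set α : (ℤ → Fin N) → ℕ → ℝ := fun x n => planeDot (f x n) (g x n) / sqNorm (f x n) with hα
  -- The component of g along f is `α`; the orthogonal component is determined by `planeDet f g =
  -- 1`.
  have hperp : ∀ x n, g x n = α x n • f x n + (sqNorm (f x n))⁻¹ • rotate (f x n) := by
    intro x n
    have h1 := hdet x n
    have h2 := (hNpos x n).ne'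
    have h3 : α x n * sqNorm (f x n) = planeDot (f x n) (g x n) := by
      simp only [hα]; field_simp
    generalize α x n = a at *
    generalize f x n = p at *
    generalize g x n = q at *
    have h4 : q = (sqNorm p)⁻¹ • (sqNorm p • q) := by rw [smul_smul, inv_mul_cancel₀ h2, one_smul]
    have h5 : sqNorm p • q = (a * sqNorm p) • p + rotate p := by
      rw [h3]
      simp only [planeDet] at h1
      ext i
      fin_cases i
      · simp [sqNorm, planeDot, rotate]; linear_combination (-p 1) * h1
      · simp [sqNorm, planeDot, rotate]; linear_combination (p 0) * h1
    rw [h4, h5, smul_add, smul_smul]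
    congr 2
    field_simp
  set d : (ℤ → Fin N) → ℕ → ℝ := fun x n => α x (n + 1) - α x n with hd
  -- Applying the next matrix to the decomposition `hperp` at time n and comparing components along
  -- f at time n + 1 gives the increment of `α`. It is at most K / (|f_n| |f_{n+1}|), so the slopes
  -- converge geometrically.
  have hdsq : ∀ x n, d x n ^ 2 * (sqNorm (f x n) * sqNorm (f x (n + 1))) ≤ K ^ 2 := by
    intro x n
    set M : Matrix (Fin 2) (Fin 2) ℝ := (A (x n) : Matrix (Fin 2) (Fin 2) ℝ) with hM
    have hfs : f x (n + 1) = M *ᵥ f x n := forwardProduct_mulVec_succ A x n v₀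
    have hgs : g x (n + 1) = M *ᵥ g x n := forwardProduct_mulVec_succ A x n w₀
    have e1 := hperp x n
    have key : d x n * sqNorm (f x (n + 1))
        = (sqNorm (f x n))⁻¹ * planeDot (f x (n + 1)) (M *ᵥ rotate (f x n)) := by
      have e2 : α x (n + 1) * sqNorm (f x (n + 1)) = planeDot (f x (n + 1)) (g x (n + 1)) := by
        have := (hNpos x (n + 1)).ne'
        simp only [hα]; field_simp
      have e3 : g x (n + 1) = α x n • f x (n + 1)
          + (sqNorm (f x n))⁻¹ • (M *ᵥ rotate (f x n)) := by
        rw [hgs, e1, mulVec_add, mulVec_smul, mulVec_smul, hfs]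
      have e4 : planeDot (f x (n + 1)) (g x (n + 1)) = α x n * sqNorm (f x (n + 1))
          + (sqNorm (f x n))⁻¹ * planeDot (f x (n + 1)) (M *ᵥ rotate (f x n)) := by
        rw [e3]
        simp only [planeDot, sqNorm, Pi.add_apply, Pi.smul_apply, smul_eq_mul]; ring
      simp only [hd]
      linear_combination e2 + e4
    have h1 := planeDot_sq_le (f x (n + 1)) (M *ᵥ rotate (f x n))
    have h2 := hKA (x n) (rotate (f x n))
    rw [sqNorm_rotate] at h2
    have p1 := hNpos x n
    have p2 := hNpos x (n + 1)
    have h3 : (d x n * sqNorm (f x (n + 1))) ^ 2 * sqNorm (f x n)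
        ≤ K ^ 2 * sqNorm (f x (n + 1)) := by
      rw [key]
      calc _ = planeDot (f x (n + 1)) (M *ᵥ rotate (f x n)) ^ 2 / sqNorm (f x n) := by
            field_simp
        _ ≤ sqNorm (f x (n + 1)) * (K ^ 2 * sqNorm (f x n)) / sqNorm (f x n) := by
            gcongr; exact h1.trans (by gcongr)
        _ = _ := by field_simp
    refine le_of_mul_le_mul_right ?_ p2
    linarith
  have hθ2 : 1 < θ ^ 2 := by nlinarith
  have hdtail : ∀ x n k, |d x (n + k)| ≤ K / (c * sqNorm (f x n)) * ((θ ^ 2)⁻¹) ^ k := by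
    intro x n k
    have p1 := hNpos x n
    have h1 := hgrow x n k
    have h2 := hgrow x n (k + 1)
    have h3 := hdsq x (n + k)
    have h4 : c * θ ^ (2 * k) * sqNorm (f x n) ≤ sqNorm (f x (n + k + 1)) := by
      refine le_trans ?_ h2
      have : θ ^ (2 * k) ≤ θ ^ (2 * (k + 1)) := pow_le_pow_right₀ hθ.le (by omega)
      gcongr
    set B := c * θ ^ (2 * k) * sqNorm (f x n) with hB
    have hBpos : 0 < B := by positivity
    have h5 : d x (n + k) ^ 2 * (B * B) ≤ K ^ 2 :=
      le_trans (mul_le_mul_of_nonneg_left (mul_le_mul h1 h4 hBpos.le (hNpos _ _).le)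
        (sq_nonneg _)) h3
    have h6 : |d x (n + k)| * B ≤ K := by
      apply abs_le_of_sq_le_sq' _ (by linarith) |>.2
      rw [mul_pow, sq_abs]; linarith
    rw [← le_div_iff₀ hBpos] at h6
    refine h6.trans (le_of_eq ?_)
    rw [hB, pow_mul, inv_pow]; field_simp
  have hr0 : 0 ≤ (θ ^ 2)⁻¹ := by positivity
  have hr1 : (θ ^ 2)⁻¹ < 1 := inv_lt_one_of_one_lt₀ hθ2
  have hgeo := summable_geometric_of_lt_one hr0 hr1
  have hdsum : ∀ x n, Summable fun k => d x (n + k) := fun x n =>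
    Summable.of_norm_bounded (hgeo.mul_left (K / (c * sqNorm (f x n))))
      (fun k => hdtail x n k)
  set a : (ℤ → Fin N) → ℝ := fun x => ∑' k, d x k with ha
  have hα0 : ∀ x, α x 0 = 0 := fun x => by
    simp only [hα]; rw [hf0, hg0]; simp [hw₀, planeDot, rotate]; left; ring
  have hrem : ∀ x n, |a x - α x n| ≤ K / (c * sqNorm (f x n)) * (1 - (θ ^ 2)⁻¹)⁻¹ := by
    intro x n
    have h0 : Summable (d x) := by simpa using hdsum x 0
    have h1 := h0.sum_add_tsum_nat_add n
    have h2 : ∑ i ∈ Finset.range n, d x i = α x n := by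
      simp only [hd]; rw [Finset.sum_range_sub, hα0, sub_zero]
    have h3 : a x - α x n = ∑' k, d x (n + k) := by
      simp only [ha]; rw [← h1, h2]; simp [add_comm]
    rw [h3]
    have h4 := tsum_of_norm_bounded (f := fun k => d x (n + k))
      ((hasSum_geometric_of_lt_one hr0 hr1).mul_left (K / (c * sqNorm (f x n))))
      (fun k => hdtail x n k)
    simpa using h4
  have hfc : ∀ n, Continuous fun x => f x n := fun n => continuous_forwardProduct_mulVec A v₀ n
  have hgc : ∀ n, Continuous fun x => g x n := fun n => continuous_forwardProduct_mulVec A w₀ n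
  have hαc : ∀ n, Continuous fun x => α x n := fun n =>
    ((hfc n).planeDot (hgc n)).div (hfc n).sqNorm fun x => (hNpos x n).ne'
  have hac : Continuous a := by
    refine continuous_tsum (fun n => (hαc (n + 1)).sub (hαc n))
      (hgeo.mul_left (K / (c * sqNorm v₀))) fun k x => ?_
    have := hdtail x 0 k
    rw [hf0, zero_add] at this
    exact this
  set L : ℝ := K / c * (1 - (θ ^ 2)⁻¹)⁻¹ with hL
  have hLpos : 0 < L := by
    have : 0 < 1 - (θ ^ 2)⁻¹ := by linarith
    positivity
  refine ⟨fun x => w₀ - a x • v₀, 2 * (1 + L ^ 2) / (c * sqNorm v₀), by positivity,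
    continuous_const.sub (hac.smul continuous_const), fun x => ?_, fun x n => ?_⟩
  · rw [← hdet0]; simp only [planeDet, Pi.sub_apply, Pi.smul_apply, smul_eq_mul]; ring
  · have p1 := hNpos x n
    have h1 : (forwardProduct A x n : Matrix (Fin 2) (Fin 2) ℝ) *ᵥ (w₀ - a x • v₀)
        = (sqNorm (f x n))⁻¹ • rotate (f x n) + (α x n - a x) • f x n := by
      rw [mulVec_sub, mulVec_smul _ (a x) v₀]
      change g x n - a x • f x n = _
      rw [hperp x n, sub_smul]; abel
    rw [h1]
    have h2 : (α x n - a x) ^ 2 ≤ (L / sqNorm (f x n)) ^ 2 := by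
      have := hrem x n
      rw [← sq_abs, abs_sub_comm]
      have e : K / (c * sqNorm (f x n)) * (1 - (θ ^ 2)⁻¹)⁻¹ = L / sqNorm (f x n) := by
        rw [hL]; field_simp
      rw [e] at this
      gcongr
    calc _ ≤ 2 * (sqNorm ((sqNorm (f x n))⁻¹ • rotate (f x n))
            + sqNorm ((α x n - a x) • f x n)) := sqNorm_add_le _ _
      _ = 2 * ((sqNorm (f x n))⁻¹ + (α x n - a x) ^ 2 * sqNorm (f x n)) := by
          rw [sqNorm_smul, sqNorm_smul, sqNorm_rotate]; field_simp
      _ ≤ 2 * ((sqNorm (f x n))⁻¹ + (L / sqNorm (f x n)) ^ 2 * sqNorm (f x n)) := by gcongr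
      _ = 2 * (1 + L ^ 2) / sqNorm (f x n) := by field_simp
      _ ≤ 2 * (1 + L ^ 2) / (c * θ ^ (2 * n) * sqNorm v₀) := by
          gcongr; exact hNlow x n
      _ = _ := by field_simp

/-- The product of `χ` along the last `n` points of the backward orbit. -/
def backwardWeight {N : ℕ} (χ : (ℤ → Fin N) → ℝ) (x : ℤ → Fin N) : ℕ → ℝ
  | 0 => 1
  | n + 1 => χ (shiftBy (-((n : ℤ) + 1)) x) * backwardWeight χ x n

lemma backwardWeight_shift {N : ℕ} (χ : (ℤ → Fin N) → ℝ) (x : ℤ → Fin N) (n : ℕ) :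
    backwardWeight χ (shiftBy 1 x) (n + 1) = χ x * backwardWeight χ x n := by
  induction n with
  | zero => simp [backwardWeight, shiftBy_shiftBy, shiftBy_zero]
  | succ n ih =>
    rw [backwardWeight, ih, shiftBy_shiftBy, backwardWeight]
    have : -(((n + 1 : ℕ) : ℤ) + 1) + 1 = -((n : ℤ) + 1) := by push_cast; ring
    rw [this]; ring

lemma continuous_backwardWeight {N : ℕ} {χ : (ℤ → Fin N) → ℝ} (hχ : Continuous χ) (n : ℕ) :
    Continuous fun x => backwardWeight χ x n := by
  induction n with
  | zero => exact continuous_const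
  | succ n ih => exact (hχ.comp (continuous_shiftBy _)).mul ih

lemma forwardProduct_mulVec_section {N : ℕ} {A : Fin N → SL(2, ℝ)}
    {e : (ℤ → Fin N) → Fin 2 → ℝ} {χ : (ℤ → Fin N) → ℝ}
    (he : ∀ x, (A (x 0) : Matrix (Fin 2) (Fin 2) ℝ) *ᵥ e x = χ x • e (shiftBy 1 x))
    (x : ℤ → Fin N) (n : ℕ) :
    (forwardProduct A x n : Matrix (Fin 2) (Fin 2) ℝ) *ᵥ e x
      = backwardWeight χ (shiftBy n x) n • e (shiftBy n x) := by
  induction n with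
  | zero =>
    rw [forwardProduct_zero_mulVec]; simp [backwardWeight, shiftBy_zero]
  | succ n ih =>
    have h1 : shiftBy ((n + 1 : ℕ) : ℤ) x = shiftBy 1 (shiftBy n x) := by
      rw [shiftBy_shiftBy]; congr 1; push_cast; ring
    have h2 := he (shiftBy n x)
    have h3 : shiftBy n x 0 = x n := by simp [shiftBy]
    rw [h3] at h2
    rw [forwardProduct_mulVec_succ, ih, mulVec_smul, h2, h1, backwardWeight_shift, smul_smul,
      mul_comm]

lemma backwardProduct_mulVec_section {N : ℕ} {A : Fin N → SL(2, ℝ)}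
    {u : (ℤ → Fin N) → Fin 2 → ℝ} {χ : (ℤ → Fin N) → ℝ}
    (hu : ∀ x, u (shiftBy 1 x) = χ x • ((A (x 0) : Matrix (Fin 2) (Fin 2) ℝ) *ᵥ u x))
    (x : ℤ → Fin N) (n : ℕ) :
    (backwardProduct A x n : Matrix (Fin 2) (Fin 2) ℝ) *ᵥ u x
      = backwardWeight χ x n • u (shiftBy (-(n : ℤ)) x) := by
  induction n with
  | zero => simp [backwardProduct, backwardWeight, shiftBy_zero]
  | succ n ih =>
    set y := shiftBy (-((n : ℤ) + 1)) x with hy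
    have h1 : shiftBy (-(n : ℤ)) x = shiftBy 1 y := by
      rw [hy, shiftBy_shiftBy]; congr 1; ring
    have h3 : y 0 = x (-((n : ℤ) + 1)) := by simp [hy, shiftBy]
    have h4 : (backwardProduct A x (n + 1) : Matrix (Fin 2) (Fin 2) ℝ)
        = (((A (y 0))⁻¹ : SL(2, ℝ)) : Matrix (Fin 2) (Fin 2) ℝ) * backwardProduct A x n := by
      rw [h3]; exact Matrix.SpecialLinearGroup.coe_mul _ _
    have h5 : (((A (y 0))⁻¹ : SL(2, ℝ)) : Matrix (Fin 2) (Fin 2) ℝ)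
        * (A (y 0) : Matrix (Fin 2) (Fin 2) ℝ) = 1 := by
      rw [← Matrix.SpecialLinearGroup.coe_mul, inv_mul_cancel, Matrix.SpecialLinearGroup.coe_one]
    have h6 : -(((n + 1 : ℕ) : ℤ)) = -((n : ℤ) + 1) := by push_cast; ring
    rw [h4, ← mulVec_mulVec, ih, h1, hu y, mulVec_smul, mulVec_smul, mulVec_mulVec, h5,
      one_mulVec, h6, ← hy, smul_smul, backwardWeight, ← hy, mul_comm]

/-- If all forward products expand a fixed vector uniformly exponentially, then the cocycle is
uniformly hyperbolic. -/
theorem uniformlyHyperbolic_of_expands {N : ℕ} (A : Fin N → SL(2, ℝ)) (v₀ : Fin 2 → ℝ)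
    (hv₀ : v₀ ≠ 0) {c θ : ℝ} (hc : 0 < c) (hθ : 1 < θ)
    (hgrow : ∀ x (n k : ℕ),
      c * θ ^ (2 * k) * sqNorm ((forwardProduct A x n : Matrix (Fin 2) (Fin 2) ℝ) *ᵥ v₀)
        ≤ sqNorm ((forwardProduct A x (n + k) : Matrix (Fin 2) (Fin 2) ℝ) *ᵥ v₀)) :
    UniformlyHyperbolic A := by
  obtain ⟨e, C, hC, hec, hdet, hcontr⟩ := exists_stable_section A v₀ hv₀ hc hθ hgrow
  have hθ0 : 0 < θ := by linarith
  have hNe : ∀ x, 1 ≤ sqNorm v₀ * sqNorm (e x) := fun x => by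
    have := planeDet_sq_le v₀ (e x)
    rwa [hdet, one_pow] at this
  have hN0 : 0 < sqNorm v₀ := sqNorm_pos hv₀
  set χ : (ℤ → Fin N) → ℝ :=
    fun x => planeDet v₀ ((A (x 0) : Matrix (Fin 2) (Fin 2) ℝ) *ᵥ e x) with hχ
  set b : (ℤ → Fin N) → ℝ :=
    fun x => planeDet v₀ ((A (x 0) : Matrix (Fin 2) (Fin 2) ℝ) *ᵥ v₀) with hb
  have hχc : Continuous χ := continuous_const.planeDet ((continuous_letter A 0).matrix_mulVec hec)
  have hbc : Continuous b :=
    continuous_const.planeDet ((continuous_letter A 0).matrix_mulVec continuous_const)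
  have hNv : ∀ x n, c * θ ^ (2 * n) * sqNorm v₀
      ≤ sqNorm ((forwardProduct A x n : Matrix (Fin 2) (Fin 2) ℝ) *ᵥ v₀) := fun x n => by
    have := hgrow x 0 n
    rwa [forwardProduct_zero_mulVec, zero_add] at this
  have hsec : ∀ x, (A (x 0) : Matrix (Fin 2) (Fin 2) ℝ) *ᵥ e x = χ x • e (shiftBy 1 x) := by
    intro x
    set z := (A (x 0) : Matrix (Fin 2) (Fin 2) ℝ) *ᵥ e x with hz
    have hexp := plane_expansion (hdet (shiftBy 1 x)) z
    set p := planeDet z (e (shiftBy 1 x)) with hp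
    -- Forward products contract both `e x` and `e (shiftBy 1 x)` but expand `v₀`, so the image of
    -- `e x` can have no component p along `v₀`.
    have hbd : ∀ n : ℕ, p ^ 2 * (c * θ ^ (2 * n) * sqNorm v₀) ≤ 2 * (C + χ x ^ 2 * C) := by
      intro n
      have h1 : (forwardProduct A (shiftBy 1 x) n : Matrix (Fin 2) (Fin 2) ℝ) *ᵥ z
          = (forwardProduct A x (n + 1) : Matrix (Fin 2) (Fin 2) ℝ) *ᵥ e x := by
        rw [hz, mulVec_mulVec, ← forwardProduct_shift, Matrix.SpecialLinearGroup.coe_mul]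
      have h2 : p • ((forwardProduct A (shiftBy 1 x) n : Matrix (Fin 2) (Fin 2) ℝ) *ᵥ v₀)
          = (forwardProduct A x (n + 1) : Matrix (Fin 2) (Fin 2) ℝ) *ᵥ e x
            + (-χ x) • ((forwardProduct A (shiftBy 1 x) n : Matrix (Fin 2) (Fin 2) ℝ) *ᵥ
              e (shiftBy 1 x)) := by
        rw [← h1]
        conv_rhs => rw [hexp]
        rw [mulVec_add, mulVec_smul, mulVec_smul, neg_smul]
        exact (add_neg_cancel_right _ _).symm
      have h3 := hcontr x (n + 1)
      have h4 := hcontr (shiftBy 1 x) n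
      have hle : ∀ m : ℕ, C / θ ^ (2 * m) ≤ C := fun m =>
        div_le_self hC.le (one_le_pow₀ hθ.le)
      calc p ^ 2 * (c * θ ^ (2 * n) * sqNorm v₀)
          ≤ p ^ 2 * sqNorm ((forwardProduct A (shiftBy 1 x) n :
              Matrix (Fin 2) (Fin 2) ℝ) *ᵥ v₀) := by gcongr; exact hNv _ _
        _ = sqNorm (p • ((forwardProduct A (shiftBy 1 x) n :
              Matrix (Fin 2) (Fin 2) ℝ) *ᵥ v₀)) := (sqNorm_smul _ _).symm
        _ ≤ _ := by
            rw [h2]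
            refine (sqNorm_add_le _ _).trans ?_
            rw [sqNorm_smul, neg_sq]
            have := h3.trans (hle _)
            have := h4.trans (hle _)
            gcongr
    have hp0 : p = 0 := by
      by_contra hne
      have hlim : Tendsto (fun n : ℕ => (p ^ 2 * c * sqNorm v₀) * (θ ^ 2) ^ n) atTop atTop :=
        (tendsto_pow_atTop_atTop_of_one_lt (by nlinarith)).const_mul_atTop (by positivity)
      obtain ⟨n, hn⟩ := (hlim.eventually_gt_atTop (2 * (C + χ x ^ 2 * C))).exists
      have := hbd n
      rw [pow_mul] at this
      linarith
    rw [hp0, zero_smul, zero_add] at hexp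
    exact hexp
  -- the weights decay exponentially
  have hw : ∀ x n, backwardWeight χ x n ^ 2 ≤ C * sqNorm v₀ / θ ^ (2 * n) := by
    intro x n
    have h1 := forwardProduct_mulVec_section hsec (shiftBy (-(n : ℤ)) x) n
    rw [shiftBy_shiftBy, add_neg_cancel, shiftBy_zero] at h1
    have h2 := hcontr (shiftBy (-(n : ℤ)) x) n
    rw [h1, sqNorm_smul] at h2
    have h3 : backwardWeight χ x n ^ 2 * 1
        ≤ backwardWeight χ x n ^ 2 * (sqNorm v₀ * sqNorm (e x)) := by gcongr; exact hNe x
    calc _ ≤ sqNorm v₀ * (backwardWeight χ x n ^ 2 * sqNorm (e x)) := by linarith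
      _ ≤ sqNorm v₀ * (C / θ ^ (2 * n)) := by gcongr
      _ = _ := by ring
  have hbound : ∀ F : (ℤ → Fin N) → ℝ, Continuous F → ∃ D, 0 < D ∧ ∀ x, |F x| ≤ D := by
    intro F hF
    obtain ⟨D, hD⟩ := isCompact_univ.exists_bound_of_continuousOn hF.continuousOn
    exact ⟨|D| + 1, by positivity, fun x => by
      have := hD x (Set.mem_univ x)
      rw [Real.norm_eq_abs] at this
      linarith [le_abs_self D]⟩
  obtain ⟨D, hD0, hD⟩ := hbound (fun x => χ x * b x) (hχc.mul hbc)
  -- The unstable direction is sought as `v₀ + β • e`. As A v₀ = χ⁻¹ v₀ + b e∘σ and A e = χ e∘σ,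
  -- invariance reads β∘σ = χ b + χ² β; iterating this into the past gives the series of `T`.
  set T : (ℤ → Fin N) → ℕ → ℝ := fun x m => backwardWeight χ x m ^ 2 *
    (χ (shiftBy (-((m : ℤ) + 1)) x) * b (shiftBy (-((m : ℤ) + 1)) x)) with hT
  have hr0 : 0 ≤ (θ ^ 2)⁻¹ := by positivity
  have hr1 : (θ ^ 2)⁻¹ < 1 := inv_lt_one_of_one_lt₀ (by nlinarith)
  have hgeo := (summable_geometric_of_lt_one hr0 hr1).mul_left (C * sqNorm v₀ * D)
  have hTb : ∀ x m, ‖T x m‖ ≤ C * sqNorm v₀ * D * ((θ ^ 2)⁻¹) ^ m := by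
    intro x m
    rw [Real.norm_eq_abs]
    simp only [hT]
    rw [abs_mul, abs_of_nonneg (sq_nonneg _)]
    calc _ ≤ C * sqNorm v₀ / θ ^ (2 * m) * D :=
          mul_le_mul (hw x m) (hD _) (abs_nonneg _) (by positivity)
      _ = _ := by rw [pow_mul, inv_pow]; field_simp
  have hTc : ∀ m, Continuous fun x => T x m := fun m =>
    ((continuous_backwardWeight hχc m).pow 2).mul
      ((hχc.comp (continuous_shiftBy _)).mul (hbc.comp (continuous_shiftBy _)))
  have hTs : ∀ x, Summable (T x) := fun x => Summable.of_norm_bounded hgeo (hTb x)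
  set β : (ℤ → Fin N) → ℝ := fun x => ∑' m, T x m with hβ
  have hβc : Continuous β := continuous_tsum hTc hgeo fun m x => hTb x m
  have hβshift : ∀ x, β (shiftBy 1 x) = χ x * b x + χ x ^ 2 * β x := by
    intro x
    simp only [hβ]
    rw [(hTs (shiftBy 1 x)).tsum_eq_zero_add, ← tsum_mul_left]
    congr 1
    · simp [hT, backwardWeight, shiftBy_shiftBy, shiftBy_zero]
    · congr 1
      funext m
      have : -(((m + 1 : ℕ) : ℤ) + 1) + 1 = -((m : ℤ) + 1) := by push_cast; ring
      simp only [hT]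
      rw [backwardWeight_shift, shiftBy_shiftBy, this]; ring
  set u : (ℤ → Fin N) → Fin 2 → ℝ := fun x => v₀ + β x • e x with hu
  have huc : Continuous u := continuous_const.add (hβc.smul hec)
  have hudet : ∀ x, planeDet (u x) (e x) = 1 := fun x => by
    simp only [hu]
    rw [planeDet_add_left, planeDet_smul_left, planeDet_self, hdet]; ring
  have hushift : ∀ x,
      u (shiftBy 1 x) = χ x • ((A (x 0) : Matrix (Fin 2) (Fin 2) ℝ) *ᵥ u x) := by
    intro x
    have h1 := plane_expansion (hdet (shiftBy 1 x)) ((A (x 0) : Matrix (Fin 2) (Fin 2) ℝ) *ᵥ v₀)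
    set a := planeDet ((A (x 0) : Matrix (Fin 2) (Fin 2) ℝ) *ᵥ v₀) (e (shiftBy 1 x)) with ha
    have h2 : χ x * a = 1 := by
      rw [ha, ← planeDet_smul_right, ← hsec, planeDet_mulVec, hdet]
    simp only [hu]
    rw [mulVec_add, mulVec_smul, h1, hsec, hβshift, smul_add, smul_add, smul_smul, h2, one_smul,
      add_assoc, smul_smul, smul_smul, smul_smul, ← add_smul]
    congr 2
    simp only [hb]; ring
  obtain ⟨E, hE0, hE⟩ := hbound (fun x => sqNorm (e x)) hec.sqNorm
  obtain ⟨U, hU0, hU⟩ := hbound (fun x => sqNorm (u x)) huc.sqNorm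
  replace hE : ∀ x, sqNorm (e x) ≤ E := fun x => (le_abs_self _).trans (hE x)
  replace hU : ∀ x, sqNorm (u x) ≤ U := fun x => (le_abs_self _).trans (hU x)
  -- The rank-one map v ↦ det(u, v) e, a projection since det(u, e) = 1.
  set P : (ℤ → Fin N) → Matrix (Fin 2) (Fin 2) ℝ :=
    fun x => !![-(e x 0 * u x 1), e x 0 * u x 0; -(e x 1 * u x 1), e x 1 * u x 0] with hP
  have hPv : ∀ x v, P x *ᵥ v = planeDet (u x) v • e x := by
    intro x v
    ext i
    fin_cases i
    · exact (mulVec_zero_apply _ _).trans (by simp [hP, planeDet]; ring)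
    · exact (mulVec_one_apply _ _).trans (by simp [hP, planeDet]; ring)
  have hext : ∀ M M' : Matrix (Fin 2) (Fin 2) ℝ, (∀ v, M *ᵥ v = M' *ᵥ v) → M = M' :=
    fun M M' h => Matrix.toLin'.injective (LinearMap.ext fun v => by simpa using h v)
  -- The factor 2 compares the Euclidean norm with the sup norm; `Q + 1` serves as a bound for √Q.
  set Q : ℝ := 2 * (C * sqNorm v₀ * (1 + E * U)) with hQ
  have hQ0 : 0 < Q := by positivity
  have hfinal : ∀ (n : ℕ) (z v : Fin 2 → ℝ),
      sqNorm z ≤ C * sqNorm v₀ * (1 + E * U) * sqNorm v / θ ^ (2 * n) →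
      ‖z‖ ≤ (Q + 1) * (θ⁻¹) ^ n * ‖v‖ := by
    intro n z v h
    apply abs_le_of_sq_le_sq' _ (by positivity) |>.2
    calc ‖z‖ ^ 2 ≤ sqNorm z := norm_sq_le_sqNorm z
      _ ≤ C * sqNorm v₀ * (1 + E * U) * (2 * ‖v‖ ^ 2) / θ ^ (2 * n) := by
          refine h.trans ?_
          gcongr
          exact sqNorm_le_norm_sq v
      _ = Q * ((θ⁻¹) ^ n * ‖v‖) ^ 2 := by
          rw [hQ, mul_pow, ← pow_mul, mul_comm n 2, inv_pow]; field_simp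
      _ ≤ (Q + 1) ^ 2 * ((θ⁻¹) ^ n * ‖v‖) ^ 2 := by gcongr; nlinarith
      _ = _ := by ring
  refine ⟨P, ?_, ?_, ?_, Q + 1, θ⁻¹, by positivity, by positivity, inv_lt_one_of_one_lt₀ hθ,
    ?_, ?_⟩
  · have he0 : ∀ i, Continuous fun x => e x i := fun i => (continuous_apply i).comp hec
    have hu0 : ∀ i, Continuous fun x => u x i := fun i => (continuous_apply i).comp huc
    refine continuous_matrix fun i j => ?_
    fin_cases i <;> fin_cases j <;> simp [hP]
    · exact ((he0 0).mul (hu0 1)).neg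
    · exact (he0 0).mul (hu0 0)
    · exact ((he0 1).mul (hu0 1)).neg
    · exact (he0 1).mul (hu0 0)
  · intro x
    refine hext _ _ fun v => ?_
    rw [← mulVec_mulVec, hPv, hPv, planeDet_smul_right, hudet, mul_one]
  · intro x
    refine hext _ _ fun v => ?_
    change _ = (P (shiftBy 1 x) * _) *ᵥ v
    rw [← mulVec_mulVec, ← mulVec_mulVec, hPv, hPv, mulVec_smul, hsec, hushift,
      planeDet_smul_left, planeDet_mulVec, smul_smul, mul_comm]
  · intro x n v hv
    rw [hPv] at hv
    apply hfinal
    have h1 : planeDet (u x) v ^ 2 ≤ sqNorm v₀ * sqNorm v := by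
      have : sqNorm v = planeDet (u x) v ^ 2 * sqNorm (e x) := by
        conv_lhs => rw [← hv]
        exact sqNorm_smul _ _
      rw [this]
      nlinarith [mul_le_mul_of_nonneg_left (hNe x) (sq_nonneg (planeDet (u x) v))]
    rw [← hv, mulVec_smul, sqNorm_smul, hv]
    have h2 : C * sqNorm v₀ * sqNorm v ≤ C * sqNorm v₀ * (1 + E * U) * sqNorm v := by
      have : 0 ≤ E * U := by positivity
      have := mul_nonneg (mul_pos hC hN0).le (sqNorm_nonneg v)
      nlinarith
    calc _ ≤ (sqNorm v₀ * sqNorm v) * (C / θ ^ (2 * n)) := by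
          exact mul_le_mul h1 (hcontr x n) (sqNorm_nonneg _)
            (mul_nonneg hN0.le (sqNorm_nonneg v))
      _ = C * sqNorm v₀ * sqNorm v / θ ^ (2 * n) := by ring
      _ ≤ _ := by gcongr
  · intro x n v hv
    rw [hPv] at hv
    apply hfinal
    have h0 : planeDet (u x) v = 0 := by
      have := hudet x
      have h := congrArg (planeDet (u x)) hv
      rw [planeDet_smul_right, this, mul_one] at h
      rw [h]; simp [planeDet]
    have h1 := plane_expansion (hudet x) v
    rw [h0, zero_smul, add_zero] at h1
    set s := planeDet v (e x) with hs
    have h2 : s ^ 2 ≤ sqNorm v * E :=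
      (planeDet_sq_le _ _).trans (mul_le_mul_of_nonneg_left (hE x) (sqNorm_nonneg v))
    rw [h1, mulVec_smul, backwardProduct_mulVec_section hushift, ← h1, sqNorm_smul, sqNorm_smul]
    have h3 := hw x n
    have h4 := hU (shiftBy (-(n : ℤ)) x)
    have h5 := sqNorm_nonneg v
    have h6 := sqNorm_nonneg (u (shiftBy (-(n : ℤ)) x))
    calc _ ≤ (sqNorm v * E) * ((C * sqNorm v₀ / θ ^ (2 * n)) * U) := by gcongr
      _ = C * sqNorm v₀ * (E * U) * sqNorm v / θ ^ (2 * n) := by ring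
      _ ≤ _ := by gcongr; linarith

/-! ### Cones and a criterion for uniform hyperbolicity. -/

/-- The product of the coordinates of `v` in the basis `(a, b)`, times `planeDet a b`. It is
nonnegative exactly when `v` or `-v` is in the closed cone spanned by `a` and `b`. -/
noncomputable def coneForm (a b v : Fin 2 → ℝ) : ℝ := planeDet a v * planeDet v b / planeDet a b

lemma coneForm_mulVec {a b a' b' v : Fin 2 → ℝ} (M : SL(2, ℝ)) (h : 0 < planeDet a b)
    (h' : 0 < planeDet a' b') {p q r s x y : ℝ}
    (ha : (M : Matrix (Fin 2) (Fin 2) ℝ) *ᵥ a = p • a' + r • b')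
    (hb : (M : Matrix (Fin 2) (Fin 2) ℝ) *ᵥ b = q • a' + s • b') (hv : v = x • a + y • b) :
    coneForm a b v = planeDet a b * (x * y) ∧
    coneForm a' b' ((M : Matrix (Fin 2) (Fin 2) ℝ) *ᵥ v)
      = planeDet a' b' * ((p * x + q * y) * (r * x + s * y)) ∧
    planeDet a b = (p * s - q * r) * planeDet a' b' := by
  have key : ∀ (a b : Fin 2 → ℝ) (x y : ℝ), planeDet a b ≠ 0 →
      coneForm a b (x • a + y • b) = planeDet a b * (x * y) := by
    intro a b x y h
    have e1 : planeDet a (x • a + y • b) = y * planeDet a b := by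
      rw [planeDet_add_right, planeDet_smul_right, planeDet_smul_right, planeDet_self]; ring
    have e2 : planeDet (x • a + y • b) b = x * planeDet a b := by
      rw [planeDet_add_left, planeDet_smul_left, planeDet_smul_left, planeDet_self]; ring
    rw [coneForm, e1, e2]; field_simp
  refine ⟨by rw [hv, key _ _ _ _ h.ne'], ?_, ?_⟩
  · have : (M : Matrix (Fin 2) (Fin 2) ℝ) *ᵥ v
        = (p * x + q * y) • a' + (r * x + s * y) • b' := by
      rw [hv, mulVec_add, mulVec_smul, mulVec_smul, ha, hb]; module
    rw [this, key _ _ _ _ h'.ne']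
  · rw [← planeDet_mulVec M, ha, hb]
    simp only [planeDet, Pi.add_apply, Pi.smul_apply, smul_eq_mul]; ring

/-- `M` maps the closed cone spanned by `a` and `b` into the closed cone spanned by `a'` and `b'`,
up to the sign `e`. -/
def MapsCone (e : ℝ) (M : SL(2, ℝ)) (a b a' b' : Fin 2 → ℝ) : Prop :=
  0 ≤ e * planeDet a' ((M : Matrix (Fin 2) (Fin 2) ℝ) *ᵥ a) ∧
  0 ≤ e * planeDet ((M : Matrix (Fin 2) (Fin 2) ℝ) *ᵥ a) b' ∧
  0 ≤ e * planeDet a' ((M : Matrix (Fin 2) (Fin 2) ℝ) *ᵥ b) ∧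
  0 ≤ e * planeDet ((M : Matrix (Fin 2) (Fin 2) ℝ) *ᵥ b) b'

/-- `M` maps the closed cone spanned by `a` and `b` into the open cone spanned by `a'` and `b'`,
up to the sign `e`. -/
def MapsConeInside (e : ℝ) (M : SL(2, ℝ)) (a b a' b' : Fin 2 → ℝ) : Prop :=
  0 < e * planeDet a' ((M : Matrix (Fin 2) (Fin 2) ℝ) *ᵥ a) ∧
  0 < e * planeDet ((M : Matrix (Fin 2) (Fin 2) ℝ) *ᵥ a) b' ∧
  0 < e * planeDet a' ((M : Matrix (Fin 2) (Fin 2) ℝ) *ᵥ b) ∧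
  0 < e * planeDet ((M : Matrix (Fin 2) (Fin 2) ℝ) *ᵥ b) b'

lemma cone_coordinates {a b : Fin 2 → ℝ} (h : 0 < planeDet a b) (v : Fin 2 → ℝ) :
    v = (planeDet v b / planeDet a b) • a + (planeDet a v / planeDet a b) • b := by
  have h0 := h.ne'
  have : planeDet a b • v = planeDet v b • a + planeDet a v • b := by
    ext i
    fin_cases i <;> simp [planeDet] <;> ring
  rw [div_eq_inv_mul, div_eq_inv_mul, mul_smul, mul_smul, ← smul_add, ← this, smul_smul,
    inv_mul_cancel₀ h0, one_smul]

/-- The entries of a matrix mapping one cone into another. -/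
lemma cone_entries {e : ℝ} (he : e ^ 2 = 1) (M : SL(2, ℝ)) {a b a' b' : Fin 2 → ℝ}
    (h : 0 < planeDet a b) (h' : 0 < planeDet a' b') {p q r s : ℝ}
    (hp : p * planeDet a' b' = e * planeDet ((M : Matrix (Fin 2) (Fin 2) ℝ) *ᵥ a) b')
    (hr : r * planeDet a' b' = e * planeDet a' ((M : Matrix (Fin 2) (Fin 2) ℝ) *ᵥ a))
    (hq : q * planeDet a' b' = e * planeDet ((M : Matrix (Fin 2) (Fin 2) ℝ) *ᵥ b) b')
    (hs : s * planeDet a' b' = e * planeDet a' ((M : Matrix (Fin 2) (Fin 2) ℝ) *ᵥ b)) :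
    planeDet a b = (p * s - q * r) * planeDet a' b' ∧
    ∀ v, ∃ x y : ℝ, coneForm a b v = planeDet a b * (x * y) ∧
      coneForm a' b' ((M : Matrix (Fin 2) (Fin 2) ℝ) *ᵥ v)
        = planeDet a' b' * ((p * x + q * y) * (r * x + s * y)) ∧
      sqNorm ((M : Matrix (Fin 2) (Fin 2) ℝ) *ᵥ v)
        = sqNorm ((p * x + q * y) • a' + (r * x + s * y) • b') := by
  have aux : ∀ {t d : ℝ}, t * planeDet a' b' = e * d → d / planeDet a' b' = e * t := by
    intro t d ht
    rw [div_eq_iff h'.ne']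
    linear_combination (-d) * he - e * ht
  have ha := cone_coordinates h' ((M : Matrix (Fin 2) (Fin 2) ℝ) *ᵥ a)
  have hb := cone_coordinates h' ((M : Matrix (Fin 2) (Fin 2) ℝ) *ᵥ b)
  rw [aux hp, aux hr] at ha
  rw [aux hq, aux hs] at hb
  constructor
  · obtain ⟨-, -, e3⟩ := coneForm_mulVec M h h' ha hb (cone_coordinates h 0)
    linear_combination e3 + (p * s - q * r) * planeDet a' b' * he
  · intro v
    have hv := cone_coordinates h v
    obtain ⟨e1, e2, -⟩ := coneForm_mulVec M h h' ha hb hv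
    refine ⟨_, _, e1, ?_, ?_⟩
    · rw [e2]
      linear_combination planeDet a' b' *
        ((p * (planeDet v b / planeDet a b) + q * (planeDet a v / planeDet a b)) *
          (r * (planeDet v b / planeDet a b) + s * (planeDet a v / planeDet a b))) * he
    · set x := planeDet v b / planeDet a b
      set y := planeDet a v / planeDet a b
      have : (M : Matrix (Fin 2) (Fin 2) ℝ) *ᵥ v
          = e • ((p * x + q * y) • a' + (r * x + s * y) • b') := by
        rw [hv, mulVec_add, mulVec_smul, mulVec_smul, ha, hb]; module
      rw [this, sqNorm_smul, he, one_mul]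

/-- In the bases of the two cones M has nonnegative entries p, q, r, s, and det M = 1 gives D = (p s
- q r) D' for the areas D, D' of the bases. Then D' (p x + q y)(r x + s y) - D x y = D' (p r x² + q
s y² + 2 q r x y), which is nonnegative when x y ≥ 0. -/
lemma MapsCone.coneForm_le {e : ℝ} (he : e ^ 2 = 1) {M : SL(2, ℝ)} {a b a' b' : Fin 2 → ℝ}
    (hM : MapsCone e M a b a' b') (h : 0 < planeDet a b) (h' : 0 < planeDet a' b')
    {v : Fin 2 → ℝ} (hv : 0 ≤ coneForm a b v) :
    coneForm a b v ≤ coneForm a' b' ((M : Matrix (Fin 2) (Fin 2) ℝ) *ᵥ v) := by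
  obtain ⟨h1, h2, h3, h4⟩ := hM
  obtain ⟨hD, hc⟩ := cone_entries he M h h' (div_mul_cancel₀ _ h'.ne') (div_mul_cancel₀ _ h'.ne')
    (div_mul_cancel₀ _ h'.ne') (div_mul_cancel₀ _ h'.ne')
  obtain ⟨x, y, e1, e2, -⟩ := hc v
  have hr := div_nonneg h1 h'.le
  have hp := div_nonneg h2 h'.le
  have hs := div_nonneg h3 h'.le
  have hq := div_nonneg h4 h'.le
  generalize e * planeDet a' ((M : Matrix (Fin 2) (Fin 2) ℝ) *ᵥ a) / planeDet a' b' = r at *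
  generalize e * planeDet ((M : Matrix (Fin 2) (Fin 2) ℝ) *ᵥ a) b' / planeDet a' b' = p at *
  generalize e * planeDet a' ((M : Matrix (Fin 2) (Fin 2) ℝ) *ᵥ b) / planeDet a' b' = s at *
  generalize e * planeDet ((M : Matrix (Fin 2) (Fin 2) ℝ) *ᵥ b) b' / planeDet a' b' = q at *
  have hxy : 0 ≤ x * y := by
    rw [e1] at hv
    exact nonneg_of_mul_nonneg_right hv h
  rw [e1, e2, hD, mul_comm (p * s - q * r), mul_assoc]
  refine mul_le_mul_of_nonneg_left ?_ h'.le
  have t1 : 0 ≤ q * r * (x * y) := by positivity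
  have t2 : 0 ≤ p * r * x ^ 2 := by positivity
  have t3 : 0 ≤ q * s * y ^ 2 := by positivity
  nlinarith

lemma MapsConeInside.mapsCone {e : ℝ} {M : SL(2, ℝ)} {a b a' b' : Fin 2 → ℝ}
    (hM : MapsConeInside e M a b a' b') : MapsCone e M a b a' b' :=
  ⟨hM.1.le, hM.2.1.le, hM.2.2.1.le, hM.2.2.2.le⟩

/-- All entries p, q, r, s are now positive, so the surplus 2 q r x y in `MapsCone.coneForm_le` is a
fixed proportion of the form. The image cone stays away from the boundary of the target cone, where
the form vanishes, so there the form dominates the squared norm. -/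
lemma MapsConeInside.exists_gain {e : ℝ} (he : e ^ 2 = 1) {M : SL(2, ℝ)} {a b a' b' : Fin 2 → ℝ}
    (hM : MapsConeInside e M a b a' b') (h : 0 < planeDet a b) (h' : 0 < planeDet a' b') :
    ∃ ε : ℝ, 0 < ε ∧ ∀ v, 0 ≤ coneForm a b v →
      (1 + ε) * coneForm a b v ≤ coneForm a' b' ((M : Matrix (Fin 2) (Fin 2) ℝ) *ᵥ v) ∧
      ε * sqNorm ((M : Matrix (Fin 2) (Fin 2) ℝ) *ᵥ v)
        ≤ coneForm a' b' ((M : Matrix (Fin 2) (Fin 2) ℝ) *ᵥ v) := by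
  obtain ⟨h1, h2, h3, h4⟩ := hM
  obtain ⟨hD, hc⟩ := cone_entries he M h h' (div_mul_cancel₀ _ h'.ne') (div_mul_cancel₀ _ h'.ne')
    (div_mul_cancel₀ _ h'.ne') (div_mul_cancel₀ _ h'.ne')
  have hr := div_pos h1 h'
  have hp := div_pos h2 h'
  have hs := div_pos h3 h'
  have hq := div_pos h4 h'
  generalize e * planeDet a' ((M : Matrix (Fin 2) (Fin 2) ℝ) *ᵥ a) / planeDet a' b' = r at *
  generalize e * planeDet ((M : Matrix (Fin 2) (Fin 2) ℝ) *ᵥ a) b' / planeDet a' b' = p at *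
  generalize e * planeDet a' ((M : Matrix (Fin 2) (Fin 2) ℝ) *ᵥ b) / planeDet a' b' = s at *
  generalize e * planeDet ((M : Matrix (Fin 2) (Fin 2) ℝ) *ᵥ b) b' / planeDet a' b' = q at *
  set D := planeDet a b
  set D' := planeDet a' b'
  have na := sqNorm_nonneg a'
  have nb := sqNorm_nonneg b'
  set S : ℝ := 1 + 4 * ((p ^ 2 + q ^ 2) * sqNorm a' + (r ^ 2 + s ^ 2) * sqNorm b') with hS
  have hS0 : 0 < S := by positivity
  set μ := min (p * r) (q * s)
  have hμ : 0 < μ := lt_min (by positivity) (by positivity)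
  -- The first bound is the relative surplus 2 q r D' / D. For the second, the form of the image is
  -- at least D' μ (x² + y²) and its squared norm at most S (x² + y²).
  refine ⟨min (2 * (q * r) * D' / D) (D' * μ / S), lt_min (by positivity) (by positivity),
    fun v hv => ?_⟩
  obtain ⟨x, y, e1, e2, e3⟩ := hc v
  have hxy : 0 ≤ x * y := by
    rw [e1] at hv
    exact nonneg_of_mul_nonneg_right hv h
  have t2 : 0 ≤ p * r * x ^ 2 := by positivity
  have t3 : 0 ≤ q * s * y ^ 2 := by positivity
  have t4 : 0 ≤ (p * s + q * r) * (x * y) := by positivity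
  constructor
  · calc _ ≤ (1 + 2 * (q * r) * D' / D) * coneForm a b v := by
          gcongr; exact min_le_left _ _
      _ = (D + 2 * (q * r) * D') * (x * y) := by rw [e1]; field_simp
      _ = D' * ((p * s + q * r) * (x * y)) := by rw [hD]; ring
      _ ≤ D' * ((p * x + q * y) * (r * x + s * y)) :=
          mul_le_mul_of_nonneg_left (by linarith) h'.le
      _ = _ := e2.symm
  · have u1 : sqNorm ((M : Matrix (Fin 2) (Fin 2) ℝ) *ᵥ v) ≤ S * (x ^ 2 + y ^ 2) := by
      rw [e3]
      refine (sqNorm_add_le _ _).trans ?_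
      rw [sqNorm_smul, sqNorm_smul]
      have w1 : (p * x + q * y) ^ 2 ≤ 2 * (p ^ 2 + q ^ 2) * (x ^ 2 + y ^ 2) := by
        nlinarith [sq_nonneg (p * y - q * x), mul_nonneg (add_nonneg (sq_nonneg p) (sq_nonneg q))
          (add_nonneg (sq_nonneg x) (sq_nonneg y))]
      have w2 : (r * x + s * y) ^ 2 ≤ 2 * (r ^ 2 + s ^ 2) * (x ^ 2 + y ^ 2) := by
        nlinarith [sq_nonneg (r * y - s * x), mul_nonneg (add_nonneg (sq_nonneg r) (sq_nonneg s))
          (add_nonneg (sq_nonneg x) (sq_nonneg y))]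
      have w3 := mul_le_mul_of_nonneg_right w1 na
      have w4 := mul_le_mul_of_nonneg_right w2 nb
      rw [hS]
      linarith [sq_nonneg x, sq_nonneg y]
    have u2 : μ * (x ^ 2 + y ^ 2) ≤ (p * x + q * y) * (r * x + s * y) := by
      have w1 : μ * x ^ 2 ≤ p * r * x ^ 2 := by gcongr; exact min_le_left _ _
      have w2 : μ * y ^ 2 ≤ q * s * y ^ 2 := by gcongr; exact min_le_right _ _
      linarith
    have nM := sqNorm_nonneg ((M : Matrix (Fin 2) (Fin 2) ℝ) *ᵥ v)
    calc _ ≤ D' * μ / S * (S * (x ^ 2 + y ^ 2)) := by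
          gcongr
          exact min_le_right _ _
      _ = D' * (μ * (x ^ 2 + y ^ 2)) := by field_simp
      _ ≤ D' * ((p * x + q * y) * (r * x + s * y)) := mul_le_mul_of_nonneg_left u2 h'.le
      _ = _ := e2.symm

/-- The upper comparison, valid on the whole plane; the reverse one holds only away from the cone
boundary and is supplied by `exists_gain`. -/
lemma coneForm_le_sqNorm {a b : Fin 2 → ℝ} (h : 0 < planeDet a b) (v : Fin 2 → ℝ) :
    coneForm a b v ≤ (sqNorm a + sqNorm b) / planeDet a b * sqNorm v := by
  rw [coneForm, div_mul_eq_mul_div]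
  have h1 := planeDet_sq_le a v
  have h2 := planeDet_sq_le v b
  have := mul_nonneg (sqNorm_nonneg a) (sqNorm_nonneg v)
  have := mul_nonneg (sqNorm_nonneg v) (sqNorm_nonneg b)
  refine div_le_div_of_nonneg_right ?_ h.le
  nlinarith [sq_nonneg (planeDet a v - planeDet v b)]

/-- The state reached after reading `n` letters of `x` from the state `0`. -/
def stateAfter {N : ℕ} (f : ℕ → Fin N → ℕ) (x : ℤ → Fin N) : ℕ → ℕ
  | 0 => 0
  | n + 1 => f (stateAfter f x n) (x n)

/-- A cone criterion for uniform hyperbolicity. Finitely many cones are the states of an automaton;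
each letter maps the cone of a state into the cone of the next state, and into its interior
unless the number of the state increases. -/
theorem uniformlyHyperbolic_of_cones {N m : ℕ} (A : Fin N → SL(2, ℝ)) (hm : 0 < m)
    (a b : ℕ → Fin 2 → ℝ) (f : ℕ → Fin N → ℕ) (hdet : ∀ s < m, 0 < planeDet (a s) (b s))
    (hf : ∀ s < m, ∀ i, f s i < m)
    (hstep : ∀ s < m, ∀ i, ∃ e : ℝ, e ^ 2 = 1 ∧
      (MapsConeInside e (A i) (a s) (b s) (a (f s i)) (b (f s i)) ∨
        (s < f s i ∧ MapsCone e (A i) (a s) (b s) (a (f s i)) (b (f s i))))) :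
    UniformlyHyperbolic A := by
  obtain ⟨K, hK, hKA⟩ := exists_sqNorm_mulVec_le A
  have hmono : ∀ s < m, ∀ i v, 0 ≤ coneForm (a s) (b s) v → coneForm (a s) (b s) v ≤
      coneForm (a (f s i)) (b (f s i)) ((A i : Matrix (Fin 2) (Fin 2) ℝ) *ᵥ v) := by
    intro s hs i v hv
    obtain ⟨e, he, h | ⟨-, h⟩⟩ := hstep s hs i
    · exact h.mapsCone.coneForm_le he (hdet s hs) (hdet _ (hf s hs i)) hv
    · exact h.coneForm_le he (hdet s hs) (hdet _ (hf s hs i)) hv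
  obtain ⟨ε, hε, hgain⟩ : ∃ ε : ℝ, 0 < ε ∧ ∀ (s : Fin m) (i : Fin N), s < f s i ∨
      ∀ v, 0 ≤ coneForm (a s) (b s) v →
        (1 + ε) * coneForm (a s) (b s) v ≤
          coneForm (a (f s i)) (b (f s i)) ((A i : Matrix (Fin 2) (Fin 2) ℝ) *ᵥ v) ∧
        ε * sqNorm ((A i : Matrix (Fin 2) (Fin 2) ℝ) *ᵥ v) ≤
          coneForm (a (f s i)) (b (f s i)) ((A i : Matrix (Fin 2) (Fin 2) ℝ) *ᵥ v) := by
    -- A gain remains valid when ε shrinks, so the finitely many pairs (state, letter) share one.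
    have hev : ∀ (s : Fin m) (i : Fin N), ∀ᶠ ε : ℝ in 𝓝[>] 0, (s < f s i ∨
      ∀ v, 0 ≤ coneForm (a s) (b s) v →
        (1 + ε) * coneForm (a s) (b s) v ≤
          coneForm (a (f s i)) (b (f s i)) ((A i : Matrix (Fin 2) (Fin 2) ℝ) *ᵥ v) ∧
        ε * sqNorm ((A i : Matrix (Fin 2) (Fin 2) ℝ) *ᵥ v) ≤
          coneForm (a (f s i)) (b (f s i)) ((A i : Matrix (Fin 2) (Fin 2) ℝ) *ᵥ v)) := by
      intro s i
      obtain ⟨e, he, h | ⟨h, -⟩⟩ := hstep s s.2 i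
      · obtain ⟨ε, hε, hg⟩ := h.exists_gain he (hdet s s.2) (hdet _ (hf s s.2 i))
        filter_upwards [Ioo_mem_nhdsGT hε] with δ hδ
        refine Or.inr fun v hv => ?_
        obtain ⟨g1, g2⟩ := hg v hv
        have := hδ.2.le
        have hn := sqNorm_nonneg ((A i : Matrix (Fin 2) (Fin 2) ℝ) *ᵥ v)
        exact ⟨le_trans (by gcongr) g1, le_trans (by gcongr) g2⟩
      · exact Eventually.of_forall fun _ => Or.inl h
    obtain ⟨ε, hε, h⟩ := ((eventually_all.2 fun s => eventually_all.2 (hev s)).and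
      self_mem_nhdsWithin).exists
    exact ⟨ε, h, hε⟩
  -- With κ^m = 1 + ε the weighted form κ^state · W grows by κ at every step. Either the state
  -- rises, which gives a factor κ, or W gains κ^m, which pays for a fall of the state by at most m
  -- - 1.
  obtain ⟨κ, hκ, hκm⟩ : ∃ κ : ℝ, 1 < κ ∧ κ ^ m = 1 + ε :=
    ⟨(1 + ε) ^ ((m : ℝ)⁻¹), Real.one_lt_rpow (by linarith) (by positivity),
      Real.rpow_inv_natCast_pow (by linarith) hm.ne'⟩
  set v₀ := a 0 + b 0 with hv₀
  have hD0 := hdet 0 hm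
  have hW0 : coneForm (a 0) (b 0) v₀ = planeDet (a 0) (b 0) := by
    rw [hv₀, coneForm, planeDet_add_right, planeDet_add_left, planeDet_self, planeDet_self,
      zero_add, add_zero]
    field_simp
  have hv₀ne : v₀ ≠ 0 := fun h => by
    rw [h] at hW0
    simp [coneForm, planeDet] at hW0
    simp only [planeDet] at hD0
    linarith
  have hN0 := sqNorm_pos hv₀ne
  set η := min ε (planeDet (a 0) (b 0) / sqNorm v₀) with hη
  have hη0 : 0 < η := lt_min hε (by positivity)
  set R : ℝ := 1 + ∑ s ∈ Finset.range m, (sqNorm (a s) + sqNorm (b s)) / planeDet (a s) (b s)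
    with hR
  have hRnn : ∀ s ∈ Finset.range m,
      0 ≤ (sqNorm (a s) + sqNorm (b s)) / planeDet (a s) (b s) := fun s hs =>
    div_nonneg (add_nonneg (sqNorm_nonneg _) (sqNorm_nonneg _)) (hdet s (Finset.mem_range.1 hs)).le
  have hR0 : 0 < R := by linarith [Finset.sum_nonneg hRnn]
  have hWR : ∀ s < m, ∀ v, coneForm (a s) (b s) v ≤ R * sqNorm v := by
    intro s hs v
    refine (coneForm_le_sqNorm (hdet s hs) v).trans ?_
    have := Finset.single_le_sum hRnn (Finset.mem_range.2 hs)
    exact mul_le_mul_of_nonneg_right (by linarith) (sqNorm_nonneg v)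
  have hκ0 : 0 < κ := by linarith
  set g : (ℤ → Fin N) → ℕ → Fin 2 → ℝ :=
    fun x n => (forwardProduct A x n : Matrix (Fin 2) (Fin 2) ℝ) *ᵥ v₀ with hg
  set W : (ℤ → Fin N) → ℕ → ℝ := fun x n =>
    coneForm (a (stateAfter f x n)) (b (stateAfter f x n)) (g x n) with hW
  have hS : ∀ x n, stateAfter f x n < m := by
    intro x n
    induction n with
    | zero => exact hm
    | succ n ih => exact hf _ ih _
  have hgs : ∀ x n, g x (n + 1) = (A (x n) : Matrix (Fin 2) (Fin 2) ℝ) *ᵥ g x n := fun x n =>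
    forwardProduct_mulVec_succ A x n v₀
  have hWinit : ∀ x, W x 0 = planeDet (a 0) (b 0) := fun x => by
    simp only [hW, hg, forwardProduct_zero_mulVec, stateAfter]; exact hW0
  have hWmono : ∀ x n, 0 ≤ W x n → W x n ≤ W x (n + 1) := by
    intro x n h
    have := hmono _ (hS x n) (x n) (g x n) h
    rw [← hgs] at this
    exact this
  have hWnn : ∀ x n, 0 ≤ W x n := by
    intro x n
    induction n with
    | zero => rw [hWinit]; exact hD0.le
    | succ n ih => exact ih.trans (hWmono x n ih)
  have hcases : ∀ x n, stateAfter f x n < stateAfter f x (n + 1) ∨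
      ((1 + ε) * W x n ≤ W x (n + 1) ∧ ε * sqNorm (g x (n + 1)) ≤ W x (n + 1)) := by
    intro x n
    rcases hgain ⟨_, hS x n⟩ (x n) with h | h
    · exact Or.inl h
    · right
      have := h (g x n) (hWnn x n)
      rw [← hgs] at this
      exact this
  have hW1 : ∀ x n, κ * (κ ^ stateAfter f x n * W x n)
      ≤ κ ^ stateAfter f x (n + 1) * W x (n + 1) := by
    intro x n
    have h0 := hWnn x n
    have h1 := hWmono x n h0
    rw [← mul_assoc, ← pow_succ']
    rcases hcases x n with h | ⟨h, -⟩
    · exact mul_le_mul (pow_le_pow_right₀ hκ.le h) h1 h0 (by positivity)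
    · calc _ ≤ κ ^ m * W x n := by gcongr; exacts [hκ.le, hS x n]
        _ = 1 * ((1 + ε) * W x n) := by rw [hκm, one_mul]
        _ ≤ _ := mul_le_mul (one_le_pow₀ hκ.le) h (by positivity) (by positivity)
  have hWk : ∀ x n k, κ ^ k * (κ ^ stateAfter f x n * W x n)
      ≤ κ ^ stateAfter f x (n + k) * W x (n + k) := by
    intro x n k
    induction k with
    | zero => simp
    | succ k ih =>
      rw [pow_succ', mul_assoc]
      exact (mul_le_mul_of_nonneg_left ih hκ0.le).trans (hW1 x (n + k))
  -- A gain step bounds the squared norm by W afresh. Each step without gain loses at most K² and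
  -- raises the state, so (K²)^state absorbs the loss.
  have hlow : ∀ x n, η * sqNorm (g x n) ≤ (K ^ 2) ^ stateAfter f x n * W x n := by
    intro x n
    have hK2 : 1 ≤ K ^ 2 := one_le_pow₀ hK
    induction n with
    | zero =>
      rw [hWinit]
      simp only [hg, forwardProduct_zero_mulVec, stateAfter, pow_zero, one_mul]
      rw [← le_div_iff₀ hN0]
      exact min_le_right _ _
    | succ n ih =>
      have h0 := hWnn x n
      have h1 := hWmono x n h0
      rcases hcases x n with h | ⟨-, h⟩
      · calc _ ≤ η * (K ^ 2 * sqNorm (g x n)) := by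
              rw [hgs]; exact mul_le_mul_of_nonneg_left (hKA _ _) hη0.le
          _ = K ^ 2 * (η * sqNorm (g x n)) := by ring
          _ ≤ K ^ 2 * ((K ^ 2) ^ stateAfter f x n * W x n) := by gcongr
          _ = (K ^ 2) ^ (stateAfter f x n + 1) * W x n := by ring
          _ ≤ _ := mul_le_mul (pow_le_pow_right₀ hK2 h) h1 h0 (by positivity)
      · calc _ ≤ ε * sqNorm (g x (n + 1)) :=
              mul_le_mul_of_nonneg_right (min_le_left _ _) (sqNorm_nonneg _)
          _ ≤ 1 * W x (n + 1) := by rw [one_mul]; exact h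
          _ ≤ _ := mul_le_mul_of_nonneg_right (one_le_pow₀ hK2) (hWnn x (n + 1))
  have hL0 : 0 < (K ^ 2) ^ m * κ ^ m * R := by positivity
  -- The form scales like a squared norm, hence θ = √κ. The denominator of c bounds the weights
  -- (K²)^state and κ^state, and R bounds the form by the squared norm.
  refine uniformlyHyperbolic_of_expands A v₀ hv₀ne (c := η / ((K ^ 2) ^ m * κ ^ m * R))
    (θ := Real.sqrt κ) (by positivity) (by rw [Real.lt_sqrt zero_le_one]; simpa using hκ)
    fun x n k => ?_
  rw [pow_mul, Real.sq_sqrt hκ0.le, div_mul_eq_mul_div, div_mul_eq_mul_div, div_le_iff₀ hL0]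
  change η * κ ^ k * sqNorm (g x n) ≤ sqNorm (g x (n + k)) * _
  have hK2 : 1 ≤ K ^ 2 := one_le_pow₀ hK
  have h0 := hWnn x n
  have h1 := hWnn x (n + k)
  calc η * κ ^ k * sqNorm (g x n) = κ ^ k * (η * sqNorm (g x n)) := by ring
    _ ≤ κ ^ k * ((K ^ 2) ^ stateAfter f x n * W x n) :=
        mul_le_mul_of_nonneg_left (hlow x n) (by positivity)
    _ ≤ κ ^ k * ((K ^ 2) ^ m * W x n) :=
        mul_le_mul_of_nonneg_left (mul_le_mul_of_nonneg_right
          (pow_le_pow_right₀ hK2 (hS x n).le) h0) (by positivity)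
    _ = (K ^ 2) ^ m * (κ ^ k * (1 * W x n)) := by ring
    _ ≤ (K ^ 2) ^ m * (κ ^ k * (κ ^ stateAfter f x n * W x n)) :=
        mul_le_mul_of_nonneg_left (mul_le_mul_of_nonneg_left (mul_le_mul_of_nonneg_right
          (one_le_pow₀ hκ.le) h0) (by positivity)) (by positivity)
    _ ≤ (K ^ 2) ^ m * (κ ^ stateAfter f x (n + k) * W x (n + k)) :=
        mul_le_mul_of_nonneg_left (hWk x n k) (by positivity)
    _ ≤ (K ^ 2) ^ m * (κ ^ m * W x (n + k)) :=
        mul_le_mul_of_nonneg_left (mul_le_mul_of_nonneg_right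
          (pow_le_pow_right₀ hκ.le (hS x (n + k)).le) h1) (by positivity)
    _ ≤ (K ^ 2) ^ m * (κ ^ m * (R * sqNorm (g x (n + k)))) :=
        mul_le_mul_of_nonneg_left (mul_le_mul_of_nonneg_left (hWR _ (hS x (n + k)) _)
          (by positivity)) (by positivity)
    _ = _ := by ring

/-! ### The matrices of the example and their action on cones. -/

/-- The hyperbolic matrix `A` of the example, with `s_A = (1, 0)` and `u_A = (0, 1)`. -/
noncomputable def matA : SL(2, ℝ) := ⟨!![1 / 7, 0; 0, 7], by norm_num [det_fin_two]⟩

/-- The hyperbolic matrix `B` of the example, with `u_B = (15, -7)` and `s_B = (-7, 15)`. -/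
noncomputable def matB : SL(2, ℝ) :=
  ⟨!![98 / 11, 45 / 11; -(45 / 11), -(136 / 77)], by norm_num [det_fin_two]⟩

/-- The path `C` of the example, with `C 0 u_B = s_A`. -/
noncomputable def matC (t : ℝ) : SL(2, ℝ) :=
  ⟨!![15 / 11, 7 / 11; (7 - 15 * t) / 16, (15 - 7 * t) / 16], by rw [det_fin_two_of]; ring⟩

/-- The vector with coordinates `X, Y` in the eigenbasis of `matB`. -/
def eigenvecB (X Y : ℝ) : Fin 2 → ℝ := ![15 * X - 7 * Y, 15 * Y - 7 * X]

lemma matA_mulVec (x y : ℝ) :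
    (matA : Matrix (Fin 2) (Fin 2) ℝ) *ᵥ ![x, y] = ![x / 7, 7 * y] := by
  ext i; fin_cases i
  · rw [Fin.zero_eta, mulVec_zero_apply]; simp [matA]; ring
  · rw [Fin.mk_one, mulVec_one_apply]; simp [matA]

lemma matA_mulVec_eigenvecB (X Y : ℝ) :
    (matA : Matrix (Fin 2) (Fin 2) ℝ) *ᵥ eigenvecB X Y
      = ![(15 * X - 7 * Y) / 7, 7 * (15 * Y - 7 * X)] := matA_mulVec _ _

lemma matB_mulVec (X Y : ℝ) :
    (matB : Matrix (Fin 2) (Fin 2) ℝ) *ᵥ eigenvecB X Y = eigenvecB (7 * X) (Y / 7) := by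
  ext i; fin_cases i
  · rw [Fin.zero_eta, mulVec_zero_apply]; simp [matB, eigenvecB]; ring
  · rw [Fin.mk_one, mulVec_one_apply]; simp [matB, eigenvecB]; ring

lemma matC_mulVec (t X Y : ℝ) :
    (matC t : Matrix (Fin 2) (Fin 2) ℝ) *ᵥ eigenvecB X Y = ![16 * X, 11 * (Y - t * X)] := by
  ext i; fin_cases i
  · rw [Fin.zero_eta, mulVec_zero_apply]; simp [matC, eigenvecB]; ring
  · rw [Fin.mk_one, mulVec_one_apply]; simp [matC, eigenvecB]; ring

lemma vec_eq_eigenvecB (x y : ℝ) :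
    ![x, y] = eigenvecB ((15 * x + 7 * y) / 176) ((7 * x + 15 * y) / 176) := by
  ext i; fin_cases i <;> simp [eigenvecB] <;> ring

lemma planeDet_vec (x y x' y' : ℝ) : planeDet ![x, y] ![x', y'] = x * y' - y * x' := by
  simp [planeDet]

lemma planeDet_eigenvecB (X Y X' Y' : ℝ) :
    planeDet (eigenvecB X Y) (eigenvecB X' Y') = 176 * (X * Y' - Y * X') := by
  simp [planeDet, eigenvecB]; ring

lemma planeDet_vec_eigenvecB (x y X Y : ℝ) :
    planeDet ![x, y] (eigenvecB X Y) = x * (15 * Y - 7 * X) - y * (15 * X - 7 * Y) := by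
  simp [planeDet, eigenvecB]

/-- The open cone spanned by `e • a` and `e • b`. -/
def InOpenCone (e : ℝ) (a b v : Fin 2 → ℝ) : Prop :=
  0 < e * planeDet a v ∧ 0 < e * planeDet v b

/-- The closed cone spanned by `e • a` and `e • b`. -/
def InClosedCone (e : ℝ) (a b v : Fin 2 → ℝ) : Prop :=
  0 ≤ e * planeDet a v ∧ 0 ≤ e * planeDet v b

lemma MapsConeInside.of_inOpenCone {e : ℝ} {M : SL(2, ℝ)} {a b a' b' : Fin 2 → ℝ}
    (ha : InOpenCone e a' b' ((M : Matrix (Fin 2) (Fin 2) ℝ) *ᵥ a))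
    (hb : InOpenCone e a' b' ((M : Matrix (Fin 2) (Fin 2) ℝ) *ᵥ b)) :
    MapsConeInside e M a b a' b' := ⟨ha.1, ha.2, hb.1, hb.2⟩

lemma MapsCone.of_inClosedCone {e : ℝ} {M : SL(2, ℝ)} {a b a' b' : Fin 2 → ℝ}
    (ha : InClosedCone e a' b' ((M : Matrix (Fin 2) (Fin 2) ℝ) *ᵥ a))
    (hb : InClosedCone e a' b' ((M : Matrix (Fin 2) (Fin 2) ℝ) *ᵥ b)) :
    MapsCone e M a b a' b' := ⟨ha.1, ha.2, hb.1, hb.2⟩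

lemma MapsConeInside.inOpenCone {e : ℝ} {M : SL(2, ℝ)} {a b a' b' : Fin 2 → ℝ}
    (h : MapsConeInside e M a b a' b') {x y : ℝ} (hx : 0 ≤ x) (hy : 0 ≤ y) (hxy : 0 < x + y) :
    InOpenCone e a' b' ((M : Matrix (Fin 2) (Fin 2) ℝ) *ᵥ (x • a + y • b)) := by
  obtain ⟨h1, h2, h3, h4⟩ := h
  have aux : ∀ {p q : ℝ}, 0 < p → 0 < q → 0 < x * p + y * q := by
    intro p q hp hq
    rcases hx.eq_or_lt with rfl | hx'
    · have : 0 < y := by linarith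
      simpa using mul_pos this hq
    · exact add_pos_of_pos_of_nonneg (mul_pos hx' hp) (mul_nonneg hy hq.le)
  rw [mulVec_add, mulVec_smul, mulVec_smul, InOpenCone, planeDet_add_right, planeDet_add_left,
    planeDet_smul_right, planeDet_smul_right, planeDet_smul_left, planeDet_smul_left]
  exact ⟨by linarith [aux h1 h3], by linarith [aux h2 h4]⟩

/-! ### The images of the vectors used under the three matrices -/

lemma matA_inOpenCone_self {l : ℝ} (hl : 0 < l) :
    MapsConeInside 1 matA ![1, l] (eigenvecB 1 4) ![1, l] (eigenvecB 1 4) := by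
  refine .of_inOpenCone ?_ ?_
  · rw [matA_mulVec, InOpenCone, planeDet_vec, planeDet_vec_eigenvecB]
    constructor <;> linarith
  · rw [matA_mulVec_eigenvecB, InOpenCone, planeDet_vec, planeDet_vec_eigenvecB]
    constructor <;> linarith

lemma matA_eigenvecB_inOpenCone {l η : ℝ} (hl : 0 < l) (hη : η ≤ 4 / 49) :
    InOpenCone (-1) ![1, l] (eigenvecB 1 4)
      ((matA : Matrix (Fin 2) (Fin 2) ℝ) *ᵥ eigenvecB 1 η) := by
  rw [matA_mulVec_eigenvecB, InOpenCone, planeDet_vec, planeDet_vec_eigenvecB]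
  constructor <;> nlinarith

lemma matB_eigenvecB_inClosedCone {η η₁ η₂ X Y : ℝ} (hX : 0 ≤ X) (hY : Y = η * X)
    (h1 : 49 * η₁ ≤ η) (h2 : η ≤ 49 * η₂) :
    InClosedCone 1 (eigenvecB 1 η₁) (eigenvecB 1 η₂)
      ((matB : Matrix (Fin 2) (Fin 2) ℝ) *ᵥ eigenvecB X Y) := by
  rw [matB_mulVec, InClosedCone, planeDet_eigenvecB, planeDet_eigenvecB, hY]
  constructor <;> nlinarith [mul_nonneg hX (sub_nonneg.2 h1), mul_nonneg hX (sub_nonneg.2 h2)]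

lemma matB_eigenvecB_inOpenCone {η₁ η₂ X Y : ℝ} (h1 : 49 * η₁ * X < Y) (h2 : Y < 49 * η₂ * X) :
    InOpenCone 1 (eigenvecB 1 η₁) (eigenvecB 1 η₂)
      ((matB : Matrix (Fin 2) (Fin 2) ℝ) *ᵥ eigenvecB X Y) := by
  rw [matB_mulVec, InOpenCone, planeDet_eigenvecB, planeDet_eigenvecB]
  constructor <;> linarith

lemma matC_eigenvecB_inOpenCone {l t X Y : ℝ} (hX : 0 < X) (hY : 16 * l * X < 11 * (Y - t * X))
    (hl : 0 < l) :
    InOpenCone 1 ![1, l] (eigenvecB 1 4)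
      ((matC t : Matrix (Fin 2) (Fin 2) ℝ) *ᵥ eigenvecB X Y) := by
  have := mul_pos hl hX
  rw [matC_mulVec, InOpenCone, planeDet_vec, planeDet_vec_eigenvecB]
  constructor <;> linarith

/-! ### The triples before the heteroclinic connection -/

/-- The cones of a triple `(A, B, C)` for which `C` maps the cone `[u_B - ε s_B, (1, 4)_B]` into
the cone `[s_A + l u_A, (1, 4)_B]`. -/
lemma uniformlyHyperbolic_of_mapsConeInside {ε l : ℝ} (hε : 0 < ε) (hl : 0 < l)
    {C : SL(2, ℝ)}
    (hC : MapsConeInside 1 C (eigenvecB 1 (-ε)) (eigenvecB 1 4) ![1, l] (eigenvecB 1 4)) :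
    UniformlyHyperbolic ![matA, matB, C] := by
  have hcomb : ∀ X Y : ℝ, eigenvecB X Y = ((4 * X - Y) / (4 + ε)) • eigenvecB 1 (-ε)
      + ((Y + ε * X) / (4 + ε)) • eigenvecB 1 4 := by
    intro X Y
    ext i; fin_cases i <;> simp [eigenvecB] <;> field_simp <;> ring
  have hCv : ∀ X Y : ℝ, 0 < X → -ε * X ≤ Y → Y ≤ 4 * X → InOpenCone 1 ![1, l] (eigenvecB 1 4)
      ((C : Matrix (Fin 2) (Fin 2) ℝ) *ᵥ eigenvecB X Y) := by
    intro X Y hX h1 h2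
    rw [hcomb X Y]
    refine hC.inOpenCone (div_nonneg (by linarith) (by linarith))
      (div_nonneg (by linarith) (by linarith)) ?_
    rw [← add_div]
    refine div_pos ?_ (by linarith)
    nlinarith
  -- State 0 is the cone around u_A and state 1 the cone around u_B; B leads to state 1, A and C to
  -- state 0. B takes the edge (1, 4)_B of cone 0 exactly to the edge (1, 4/49)_B of cone 1, which
  -- is allowed because the state increases.
  refine uniformlyHyperbolic_of_cones (m := 2) _ (by norm_num)
    (fun s => if s = 0 then ![1, l] else eigenvecB 1 (-ε))
    (fun s => if s = 0 then eigenvecB 1 4 else eigenvecB 1 (4 / 49))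
    (fun _ i => if i = 1 then 1 else 0) ?_ ?_ ?_
  · intro s hs
    interval_cases s
    · simp only [if_true]; rw [planeDet_vec_eigenvecB]; linarith
    · simp only [one_ne_zero, if_false]; rw [planeDet_eigenvecB]; linarith
  · intro s _ i
    split_ifs <;> norm_num
  · intro s hs i
    interval_cases s <;> fin_cases i <;> simp [-sq_eq_one_iff, -exists_eq_or_imp]
    · exact ⟨1, by norm_num, matA_inOpenCone_self hl⟩
    · refine ⟨1, by norm_num, Or.inr (.of_inClosedCone ?_ ?_)⟩
      · rw [vec_eq_eigenvecB]
        exact matB_eigenvecB_inClosedCone (η := (7 + 15 * l) / (15 + 7 * l)) (by positivity)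
          (by field_simp) (le_trans (by linarith : 49 * -ε ≤ 0) (by positivity))
          (by rw [div_le_iff₀ (by positivity)]; linarith)
      · exact matB_eigenvecB_inClosedCone (η := 4) (by norm_num) (by norm_num) (by linarith)
          (by norm_num)
    · refine ⟨1, by norm_num, (.of_inOpenCone ?_ ?_)⟩
      · have h0 : 0 ≤ ε * ((15 * 1 + 7 * l) / 176) := by positivity
        have := hCv ((15 * 1 + 7 * l) / 176) ((7 * 1 + 15 * l) / 176) (by positivity)
          (by linarith) (by linarith)
        rwa [← vec_eq_eigenvecB] at this
      · exact hCv 1 4 (by norm_num) (by linarith) (by norm_num)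
    · exact ⟨-1, by norm_num, (.of_inOpenCone
        (matA_eigenvecB_inOpenCone hl (by linarith))
        (matA_eigenvecB_inOpenCone hl (by linarith)))⟩
    · exact ⟨1, by norm_num, (.of_inOpenCone
        (matB_eigenvecB_inOpenCone (by linarith) (by linarith))
        (matB_eigenvecB_inOpenCone (by linarith) (by linarith)))⟩
    · exact ⟨1, by norm_num, (.of_inOpenCone
        (hCv _ _ (by norm_num) (by linarith) (by linarith))
        (hCv _ _ (by norm_num) (by linarith) (by linarith)))⟩

/-! ### Connectedness of the set of matrices mapping one cone inside another. -/

/-- The matrices of determinant one with positive entries. -/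
def positiveSL : Set SL(2, ℝ) := {Q | ∀ i j, 0 < Q i j}

/-- The upper left entry, written as an exponential, and the two off-diagonal entries are free, and
the determinant fixes the last entry, which is then automatically positive. -/
lemma isPreconnected_positiveSL : IsPreconnected positiveSL := by
  let φ : ℝ × ℝ × ℝ → SL(2, ℝ) := fun z =>
    ⟨!![Real.exp z.1, z.2.1; z.2.2, (1 + z.2.1 * z.2.2) * Real.exp (-z.1)], by
      rw [det_fin_two_of, Real.exp_neg]
      have := (Real.exp_pos z.1).ne'
      field_simp
      ring⟩
  have hφ : Continuous φ := by
    refine Continuous.subtype_mk (continuous_matrix fun i j => ?_) _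
    fin_cases i <;> fin_cases j <;> simp <;> fun_prop
  have himg : φ '' (Set.univ ×ˢ (Set.Ioi 0 ×ˢ Set.Ioi 0)) = positiveSL := by
    ext Q
    constructor
    · rintro ⟨⟨w, q, r⟩, ⟨-, hq, hr⟩, rfl⟩
      have hq' : 0 < q := hq
      have hr' : 0 < r := hr
      intro i j
      fin_cases i <;> fin_cases j <;> simp [φ] <;> first | assumption | positivity
    · intro hQ
      refine ⟨(Real.log (Q 0 0), Q 0 1, Q 1 0), ⟨trivial, hQ 0 1, hQ 1 0⟩, ?_⟩
      have h0 := hQ 0 0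
      have hd := sl_det_entries Q
      ext i j
      fin_cases i <;> fin_cases j <;> simp [φ, Real.exp_neg, Real.exp_log h0]
      field_simp
      linarith
  rw [← himg]
  exact (isPreconnected_univ.prod (isPreconnected_Ioi.prod isPreconnected_Ioi)).image φ
    hφ.continuousOn

/-- The matrix of determinant one whose columns are positive multiples of `v` and `w`. -/
noncomputable def basisSL (v w : Fin 2 → ℝ) (h : 0 < planeDet v w) : SL(2, ℝ) :=
  ⟨!![v 0 / planeDet v w, w 0; v 1 / planeDet v w, w 1], by
    rw [det_fin_two_of]
    have := h.ne'
    field_simp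
    simp only [planeDet]; ring⟩

lemma inv_mul_mul_apply (H C G : SL(2, ℝ)) (j : Fin 2) :
    (H⁻¹ * C * G) 0 j = planeDet ((C : Matrix (Fin 2) (Fin 2) ℝ) *ᵥ fun i => G i j)
      (fun i => H i 1) ∧
    (H⁻¹ * C * G) 1 j = planeDet (fun i => H i 0)
      ((C : Matrix (Fin 2) (Fin 2) ℝ) *ᵥ fun i => G i j) := by
  have h : ((H⁻¹ * C * G : SL(2, ℝ)) : Matrix (Fin 2) (Fin 2) ℝ)
      = (H : Matrix (Fin 2) (Fin 2) ℝ).adjugate * C * G := by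
    rw [Matrix.SpecialLinearGroup.coe_mul, Matrix.SpecialLinearGroup.coe_mul,
      Matrix.SpecialLinearGroup.coe_inv]
  rw [h, adjugate_fin_two]
  simp only [planeDet, mulVec_zero_apply, mulVec_one_apply, Matrix.mul_apply, Fin.sum_univ_two,
    of_apply, cons_val_zero, cons_val_one, cons_val', cons_val_fin_one]
  constructor <;> ring

lemma basisSL_col_zero {v w : Fin 2 → ℝ} (h : 0 < planeDet v w) :
    (fun i => basisSL v w h i 0) = (planeDet v w)⁻¹ • v := by
  ext i; fin_cases i <;> simp [basisSL] <;> ring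

lemma basisSL_col_one {v w : Fin 2 → ℝ} (h : 0 < planeDet v w) :
    (fun i => basisSL v w h i 1) = w := by
  ext i; fin_cases i <;> simp [basisSL]

/-- In bases adapted to the two cones the entries of C are, up to positive factors, the four
determinants in `MapsConeInside`. -/
lemma mem_positiveSL_iff {g₁ g₂ h₁ h₂ : Fin 2 → ℝ} (hg : 0 < planeDet g₁ g₂)
    (hh : 0 < planeDet h₁ h₂) (C : SL(2, ℝ)) :
    (basisSL h₁ h₂ hh)⁻¹ * C * basisSL g₁ g₂ hg ∈ positiveSL ↔
      MapsConeInside 1 C g₁ g₂ h₁ h₂ := by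
  have e := inv_mul_mul_apply (basisSL h₁ h₂ hh) C (basisSL g₁ g₂ hg)
  change (∀ i j, 0 < _) ↔ _
  rw [Fin.forall_fin_two, Fin.forall_fin_two, Fin.forall_fin_two, (e 0).1, (e 0).2, (e 1).1,
    (e 1).2, basisSL_col_zero, basisSL_col_zero, basisSL_col_one, basisSL_col_one, mulVec_smul,
    planeDet_smul_left, planeDet_smul_left, planeDet_smul_left, planeDet_smul_right,
    mul_pos_iff_of_pos_left (inv_pos.2 hg), mul_pos_iff_of_pos_left (inv_pos.2 hh),
    mul_pos_iff_of_pos_left (inv_pos.2 hh), mul_pos_iff_of_pos_left (inv_pos.2 hg)]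
  simp only [MapsConeInside, one_mul]
  tauto

lemma isPreconnected_mapsConeInside {g₁ g₂ h₁ h₂ : Fin 2 → ℝ} (hg : 0 < planeDet g₁ g₂)
    (hh : 0 < planeDet h₁ h₂) : IsPreconnected {C | MapsConeInside 1 C g₁ g₂ h₁ h₂} := by
  have : {C | MapsConeInside 1 C g₁ g₂ h₁ h₂}
      = (fun Q => basisSL h₁ h₂ hh * Q * (basisSL g₁ g₂ hg)⁻¹) '' positiveSL := by
    ext C
    change MapsConeInside 1 C g₁ g₂ h₁ h₂ ↔ _
    rw [← mem_positiveSL_iff hg hh]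
    constructor
    · intro h
      exact ⟨_, h, by group⟩
    · rintro ⟨Q, hQ, rfl⟩
      convert hQ using 1
      group
  rw [this]
  exact isPreconnected_positiveSL.image _ (by fun_prop)

/-! ### The triple (A, B, -AB) and the path before the connection. -/

lemma coe_matA_mul_matB :
    ((matA * matB : SL(2, ℝ)) : Matrix (Fin 2) (Fin 2) ℝ)
      = !![14 / 11, 45 / 77; -(315 / 11), -(136 / 11)] := by
  rw [Matrix.SpecialLinearGroup.coe_mul]
  ext i j
  fin_cases i <;> fin_cases j <;> simp [matA, matB, Matrix.mul_apply, Fin.sum_univ_two] <;>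
    norm_num

lemma coe_neg_matA_mul_matB :
    ((-(matA * matB) : SL(2, ℝ)) : Matrix (Fin 2) (Fin 2) ℝ)
      = !![-(14 / 11), -(45 / 77); 315 / 11, 136 / 11] := by
  rw [Matrix.SpecialLinearGroup.coe_neg, coe_matA_mul_matB]
  ext i j
  fin_cases i <;> fin_cases j <;> simp

lemma coe_matB_mul_matA :
    ((matB * matA : SL(2, ℝ)) : Matrix (Fin 2) (Fin 2) ℝ)
      = !![14 / 11, 315 / 11; -(45 / 77), -(136 / 11)] := by
  rw [Matrix.SpecialLinearGroup.coe_mul]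
  ext i j
  fin_cases i <;> fin_cases j <;> simp [matA, matB, Matrix.mul_apply, Fin.sum_univ_two] <;>
    norm_num

/-- B takes both edges into the fourth quadrant, and A multiplies slopes by 49, which makes them
steeper than the slope -53/13 of (1, 4)_B; the minus sign puts the images in the cone itself. No
smallness of ε or l is needed, so one base triple serves every t < 0. -/
lemma neg_matA_mul_matB_mapsConeInside {ε l : ℝ} (hε : 0 < ε) (hl : 0 < l) :
    MapsConeInside 1 (-(matA * matB)) (eigenvecB 1 (-ε)) (eigenvecB 1 4)
      ![1, l] (eigenvecB 1 4) := by
  have h : ∀ Y : ℝ, ((-(matA * matB) : SL(2, ℝ)) : Matrix (Fin 2) (Fin 2) ℝ) *ᵥ eigenvecB 1 Y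
      = ![-(eigenvecB 7 (Y / 7) 0 / 7), -(7 * eigenvecB 7 (Y / 7) 1)] := by
    intro Y
    rw [coe_neg_matA_mul_matB]
    ext i
    fin_cases i
    · rw [Fin.zero_eta, mulVec_zero_apply]; simp [eigenvecB]; ring
    · rw [Fin.mk_one, mulVec_one_apply]; simp [eigenvecB]; ring
  refine .of_inOpenCone ?_ ?_ <;>
  · rw [h, InOpenCone, planeDet_vec, planeDet_vec_eigenvecB]
    simp only [eigenvecB, cons_val_zero, cons_val_one]
    constructor <;> nlinarith [mul_pos hl hε]

lemma matC_mapsConeInside {ε l t : ℝ} (hl : 0 < l) (hε : 0 < ε) (h : 16 * l < 11 * (-ε - t)) :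
    MapsConeInside 1 (matC t) (eigenvecB 1 (-ε)) (eigenvecB 1 4) ![1, l] (eigenvecB 1 4) :=
  .of_inOpenCone (matC_eigenvecB_inOpenCone one_pos (by linarith) hl)
    (matC_eigenvecB_inOpenCone one_pos (by linarith) hl)

lemma neg_matA_mul_matB_mem_hyperbolicLocus :
    ![matA, matB, -(matA * matB)] ∈ hyperbolicLocus 3 :=
  uniformlyHyperbolic_of_mapsConeInside one_pos one_pos
    (neg_matA_mul_matB_mapsConeInside one_pos one_pos)

/-- Before the heteroclinic connection, the path stays in the component of `(A, B, -AB)`. -/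
lemma matC_mem_component {t : ℝ} (ht : t < 0) :
    ![matA, matB, matC t]
      ∈ connectedComponentIn (hyperbolicLocus 3) ![matA, matB, -(matA * matB)] := by
  -- Any ε < -t leaves room for C(t) to send the edge u_B - ε s_B strictly past s_A; l is then taken
  -- small enough.
  set ε : ℝ := -t / 2 with hε
  have hε0 : 0 < ε := by linarith
  set l : ℝ := -t / 100 with hl
  have hl0 : 0 < l := by rw [hl]; linarith
  have hg : 0 < planeDet (eigenvecB 1 (-ε)) (eigenvecB 1 4) := by
    rw [planeDet_eigenvecB]; linarith
  have hh : 0 < planeDet ![1, l] (eigenvecB 1 4) := by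
    rw [planeDet_vec_eigenvecB]; linarith
  have hpre := (isPreconnected_mapsConeInside hg hh).image
    (fun C => (![matA, matB, C] : Fin 3 → SL(2, ℝ)))
    (Continuous.continuousOn (continuous_pi fun i => by
      fin_cases i <;> simp <;> fun_prop))
  refine hpre.subset_connectedComponentIn
    (Set.mem_image_of_mem _ (neg_matA_mul_matB_mapsConeInside hε0 hl0)) ?_
    (Set.mem_image_of_mem _ (matC_mapsConeInside hl0 hε0 (by linarith)))
  rintro _ ⟨C, hC, rfl⟩
  exact uniformlyHyperbolic_of_mapsConeInside hε0 hl0 hC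

/-! ### Eigendirections and the positive free component. -/

lemma spansUnstable_of_entries {M : SL(2, ℝ)} {x y : ℝ} (hx : x ≠ 0 ∨ y ≠ 0) (μ : ℝ)
    (hμ : 1 < |μ|) (h0 : M 0 0 * x + M 0 1 * y = μ * x) (h1 : M 1 0 * x + M 1 1 * y = μ * y) :
    SpansUnstable M ![x, y] := by
  refine ⟨fun h => ?_, μ, hμ, ?_⟩
  · have e0 := congrFun h 0
    have e1 := congrFun h 1
    simp at e0 e1
    tauto
  · ext i
    fin_cases i
    · rw [Fin.zero_eta, mulVec_zero_apply]; simpa using h0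
    · rw [Fin.mk_one, mulVec_one_apply]; simpa using h1

lemma spansStable_of_entries {M : SL(2, ℝ)} {x y : ℝ} (hx : x ≠ 0 ∨ y ≠ 0) (μ : ℝ)
    (hμ : |μ| < 1) (h0 : M 0 0 * x + M 0 1 * y = μ * x) (h1 : M 1 0 * x + M 1 1 * y = μ * y) :
    SpansStable M ![x, y] := by
  refine ⟨fun h => ?_, μ, hμ, ?_⟩
  · have e0 := congrFun h 0
    have e1 := congrFun h 1
    simp at e0 e1
    tauto
  · ext i
    fin_cases i
    · rw [Fin.zero_eta, mulVec_zero_apply]; simpa using h0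
    · rw [Fin.mk_one, mulVec_one_apply]; simpa using h1

lemma coe_matA : (matA : Matrix (Fin 2) (Fin 2) ℝ) = !![1 / 7, 0; 0, 7] := rfl

lemma coe_matB : (matB : Matrix (Fin 2) (Fin 2) ℝ)
    = !![98 / 11, 45 / 11; -(45 / 11), -(136 / 77)] := rfl

lemma spansUnstable_matB : SpansUnstable matB ![15, -7] := by
  refine spansUnstable_of_entries (by norm_num) 7 (by norm_num) ?_ ?_ <;>
    rw [coe_matB] <;> norm_num

lemma spansStable_matA : SpansStable matA ![1, 0] := by
  refine spansStable_of_entries (by norm_num) (1 / 7) (by norm_num [abs_lt]) ?_ ?_ <;>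
    rw [coe_matA] <;> norm_num

lemma inPositiveFreeComponent_matA_matB : InPositiveFreeComponent matA matB := by
  -- The trace of AB is -122/11 = -(11 + 1/11), so AB and BA have eigenvalues -11 and -1/11.
  refine ⟨?_, ?_, ?_, ![15, -7], ![7, -3], ![21, -1], ![1, 0], ![0, 1], ![-1, 21], ![-3, 7],
    ![-7, 15], spansUnstable_matB, ?_, ?_, spansStable_matA, ?_, ?_, ?_, ?_, ?_⟩
  · rw [coe_matA, trace_fin_two_of]; norm_num
  · rw [coe_matB, trace_fin_two_of]; norm_num
  · rw [coe_matA_mul_matB, trace_fin_two_of]; norm_num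
  · refine spansUnstable_of_entries (by norm_num) (-11) (by norm_num) ?_ ?_ <;>
      rw [coe_matB_mul_matA] <;> norm_num
  · refine spansStable_of_entries (by norm_num) (-1 / 11) (by norm_num [abs_lt]) ?_ ?_ <;>
      rw [coe_matB_mul_matA] <;> norm_num
  · refine spansUnstable_of_entries (by norm_num) 7 (by norm_num) ?_ ?_ <;>
      rw [coe_matA] <;> norm_num
  · refine spansUnstable_of_entries (by norm_num) (-11) (by norm_num) ?_ ?_ <;>
      rw [coe_matA_mul_matB] <;> norm_num
  · refine spansStable_of_entries (by norm_num) (-1 / 11) (by norm_num [abs_lt]) ?_ ?_ <;>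
      rw [coe_matA_mul_matB] <;> norm_num
  · refine spansStable_of_entries (by norm_num) (1 / 7) (by norm_num [abs_lt]) ?_ ?_ <;>
      rw [coe_matB] <;> norm_num
  · have hpos : ∀ i j : Fin 8, i < j → 0 < planeDet
        ((![![15, -7], ![7, -3], ![21, -1], ![1, 0], ![0, 1], ![-1, 21], ![-3, 7],
          ![-7, 15]] : Fin 8 → Fin 2 → ℝ) i)
        ((![![15, -7], ![7, -3], ![21, -1], ![1, 0], ![0, 1], ![-1, 21], ![-3, 7],
          ![-7, 15]] : Fin 8 → Fin 2 → ℝ) j) := by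
      intro i j hij
      fin_cases i <;> fin_cases j <;> first
        | exact absurd hij (by decide)
        | norm_num [planeDet]
    intro i j k hij hjk
    exact mul_pos (mul_pos (hpos i j hij) (hpos j k hjk)) (hpos i k (hij.trans hjk))

/-! ### Cones after the heteroclinic connection. -/

/-- The first boundary vectors of the cones of the triple with `C u_B = A⁻ⁿ p` for a direction `p`
far from the fixed directions of `A`: the cone `0` is around `u_A`, the cones `1, …, n`
accumulate at `u_B`, the cone `n + 1` is around `u_B`, and the cones `n + 2, …, 2 n + 2` are the
images of the cone `n + 1` under `C`, `A C`, …, `Aⁿ C`. -/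
noncomputable def coneLeft (n s : ℕ) : Fin 2 → ℝ :=
  if s = 0 then ![1, (1 / 49) ^ n / 100]
  else if s ≤ n then eigenvecB 1 (2 / 7 * (1 / 49) ^ s)
  else if s = n + 1 then eigenvecB 1 (-(1 / 60) * (1 / 49) ^ n)
  else ![1, -(11 / 60) * (1 / 49) ^ (2 * n + 2 - s)]

/-- The second boundary vectors of the cones; see `coneLeft`. -/
noncomputable def coneRight (n s : ℕ) : Fin 2 → ℝ :=
  if s ≤ n then eigenvecB 1 (4 * (1 / 49) ^ s)
  else if s = n + 1 then eigenvecB 1 (4 / 49 * (1 / 49) ^ n)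
  else ![1, -(363 / 3136) * (1 / 49) ^ (2 * n + 2 - s)]

/-- The transitions between the cones; see `coneLeft`. -/
def coneNext (n s : ℕ) (i : Fin 3) : ℕ :=
  if i = 0 then if n + 2 ≤ s ∧ s < 2 * n + 2 then s + 1 else 0
  else if i = 1 then if s ≤ n then s + 1 else if s = n + 1 then n + 1 else 1
  else if s = n + 1 then n + 2 else 0

lemma coneLeft_zero (n : ℕ) : coneLeft n 0 = ![1, (1 / 49) ^ n / 100] := rfl

lemma coneRight_zero (n : ℕ) : coneRight n 0 = eigenvecB 1 4 := by simp [coneRight]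

lemma coneLeft_of_le {n s : ℕ} (h0 : 1 ≤ s) (h : s ≤ n) :
    coneLeft n s = eigenvecB 1 (2 / 7 * (1 / 49) ^ s) := by
  rw [coneLeft, if_neg (by omega), if_pos h]

lemma coneRight_of_le {n s : ℕ} (h : s ≤ n) :
    coneRight n s = eigenvecB 1 (4 * (1 / 49) ^ s) := by
  rw [coneRight, if_pos h]

lemma coneLeft_core (n : ℕ) :
    coneLeft n (n + 1) = eigenvecB 1 (-(1 / 60) * (1 / 49) ^ n) := by
  rw [coneLeft, if_neg (by omega), if_neg (by omega), if_pos rfl]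

lemma coneRight_core (n : ℕ) :
    coneRight n (n + 1) = eigenvecB 1 (4 / 49 * (1 / 49) ^ n) := by
  rw [coneRight, if_neg (by omega), if_pos rfl]

lemma coneLeft_of_gt {n s : ℕ} (h : n + 2 ≤ s) :
    coneLeft n s = ![1, -(11 / 60) * (1 / 49) ^ (2 * n + 2 - s)] := by
  rw [coneLeft, if_neg (by omega), if_neg (by omega), if_neg (by omega)]

lemma coneRight_of_gt {n s : ℕ} (h : n + 2 ≤ s) :
    coneRight n s = ![1, -(363 / 3136) * (1 / 49) ^ (2 * n + 2 - s)] := by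
  rw [coneRight, if_neg (by omega), if_neg (by omega)]

lemma matA_vec_inOpenCone {l σ : ℝ} (hl : 0 < l) (h : σ ≤ -(363 / 3136)) :
    InOpenCone (-1) ![1, l] (eigenvecB 1 4)
      ((matA : Matrix (Fin 2) (Fin 2) ℝ) *ᵥ ![1, σ]) := by
  rw [matA_mulVec, InOpenCone, planeDet_vec, planeDet_vec_eigenvecB]
  constructor <;> linarith

/-- The direction (1, -11/60) has Y / X slightly above 2/7, which is where the constant 2/7 in
`coneLeft` comes from. -/
lemma matB_vec_inOpenCone {σ : ℝ} (hσ : -(11 / 60) ≤ σ) :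
    InOpenCone 1 (eigenvecB 1 (2 / 7 * (1 / 49) ^ 1)) (eigenvecB 1 (4 * (1 / 49) ^ 1))
      ((matB : Matrix (Fin 2) (Fin 2) ℝ) *ᵥ ![1, σ]) := by
  rw [vec_eq_eigenvecB]
  exact matB_eigenvecB_inOpenCone (by linarith) (by linarith)

/-- Since 2/7 > 1/4, the image has slope at least (11/16)(2/7 - 1/4) u = 11 u / 448, which exceeds u
/ 100. -/
lemma matC_eigenvecB_inOpenCone_base {u X Y : ℝ} (hu : 0 < u) (hX : 0 < X)
    (hY : 2 / 7 * u * X ≤ Y) :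
    InOpenCone 1 ![1, u / 100] (eigenvecB 1 4)
      ((matC (u / 4) : Matrix (Fin 2) (Fin 2) ℝ) *ᵥ eigenvecB X Y) := by
  have := mul_pos hu hX
  exact matC_eigenvecB_inOpenCone hX (by linarith) (by linarith)

lemma matC_vec_inOpenCone_base {u σ : ℝ} (hu : 0 < u) (hu1 : u ≤ 1) (hσ : -(11 / 60) ≤ σ) :
    InOpenCone 1 ![1, u / 100] (eigenvecB 1 4)
      ((matC (u / 4) : Matrix (Fin 2) (Fin 2) ℝ) *ᵥ ![1, σ]) := by
  have h := matC_eigenvecB_inOpenCone_base (X := (15 * 1 + 7 * σ) / 176)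
    (Y := (7 * 1 + 15 * σ) / 176) hu (by linarith) (by nlinarith)
  rwa [← vec_eq_eigenvecB] at h

/-- After the heteroclinic connection there are hyperbolic triples on the path. -/
lemma uniformlyHyperbolic_matC {n : ℕ} (hn : 1 ≤ n) :
    UniformlyHyperbolic ![matA, matB, matC ((1 / 49) ^ n / 4)] := by
  have hpow : ∀ k : ℕ, (0 : ℝ) < (1 / 49) ^ k := fun k => by positivity
  have hpow1 : ∀ k : ℕ, ((1 : ℝ) / 49) ^ k ≤ 1 := fun k =>
    pow_le_one₀ (by norm_num) (by norm_num)
  have hpow2 : ∀ k : ℕ, 1 ≤ k → ((1 : ℝ) / 49) ^ k ≤ 1 / 49 := fun k hk =>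
    pow_le_of_le_one (by norm_num) (by norm_num) (by omega)
  have hu := hpow n
  have hu1 := hpow2 n hn
  have hl : (0 : ℝ) < (1 / 49) ^ n / 100 := by positivity
  -- With u = 49⁻ⁿ and t = u/4, the core cone n + 1 is the range [-u/60, 4u/49] of Y / X. C maps it
  -- exactly onto the slopes from -(11/60) u to -(363/3136) u, and each A multiplies these by 49.
  -- After n steps the slopes lie in [-11/60, -363/3136], and one more A lands inside cone 0. B
  -- escapes from this chain into cone 1 and C into cone 0. Edges meet only in the chains 0, …, n +
  -- 1 under B and n + 1, …, 2 n + 2 under C and A, where the state increases.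
  refine uniformlyHyperbolic_of_cones (m := 2 * n + 3) _ (by omega) (coneLeft n) (coneRight n)
    (coneNext n) ?_ ?_ ?_
  · intro s hs
    rcases Nat.eq_zero_or_pos s with rfl | h0
    · rw [coneLeft_zero, coneRight_zero, planeDet_vec_eigenvecB]; linarith
    rcases le_or_gt s n with h1 | h1
    · rw [coneLeft_of_le h0 h1, coneRight_of_le h1, planeDet_eigenvecB]; linarith [hpow s]
    rcases (show s = n + 1 ∨ n + 2 ≤ s by omega) with rfl | h2
    · rw [coneLeft_core, coneRight_core, planeDet_eigenvecB]; linarith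
    · rw [coneLeft_of_gt h2, coneRight_of_gt h2, planeDet_vec]; linarith [hpow (2 * n + 2 - s)]
  · intro s hs i
    unfold coneNext
    split_ifs <;> omega
  intro s hs i
  rcases Nat.eq_zero_or_pos s with rfl | h0
  · fin_cases i
    · have hf : coneNext n 0 0 = 0 := by simp [coneNext]
      refine ⟨1, by norm_num, Or.inl ?_⟩
      change MapsConeInside 1 matA _ _ (coneLeft n (coneNext n 0 0)) (coneRight n (coneNext n 0 0))
      rw [hf, coneLeft_zero, coneRight_zero]
      exact matA_inOpenCone_self hl
    · have hf : coneNext n 0 1 = 1 := by simp [coneNext]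
      refine ⟨1, by norm_num, Or.inr ⟨by change 0 < coneNext n 0 1; omega, ?_⟩⟩
      change MapsCone 1 matB _ _ (coneLeft n (coneNext n 0 1)) (coneRight n (coneNext n 0 1))
      rw [hf, coneLeft_zero, coneRight_zero, coneLeft_of_le le_rfl hn, coneRight_of_le hn]
      refine .of_inClosedCone ?_ (matB_eigenvecB_inClosedCone (η := 4) (by norm_num)
        (by norm_num) (by norm_num) (by norm_num))
      rw [vec_eq_eigenvecB]
      set l : ℝ := (1 / 49) ^ n / 100
      exact matB_eigenvecB_inClosedCone (η := (7 + 15 * l) / (15 + 7 * l)) (by positivity)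
        (by field_simp) (by rw [le_div_iff₀ (by positivity)]; linarith)
        (by rw [div_le_iff₀ (by positivity)]; linarith)
    · have hf : coneNext n 0 2 = 0 := by simp [coneNext]
      refine ⟨1, by norm_num, Or.inl ?_⟩
      change MapsConeInside 1 (matC _) _ _ (coneLeft n (coneNext n 0 2))
        (coneRight n (coneNext n 0 2))
      rw [hf, coneLeft_zero, coneRight_zero]
      exact .of_inOpenCone
        (matC_vec_inOpenCone_base hu (hpow1 n) (by linarith))
        (matC_eigenvecB_inOpenCone_base hu one_pos (by linarith))
  rcases le_or_gt s n with h1 | h1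
  · have hs1 := hpow2 s h0
    have hs0 := hpow s
    have hsn : ((1 : ℝ) / 49) ^ n ≤ (1 / 49) ^ s :=
      pow_le_pow_of_le_one (by norm_num) (by norm_num) h1
    rw [coneLeft_of_le h0 h1, coneRight_of_le h1]
    fin_cases i
    · have hf : coneNext n s 0 = 0 := by simp [coneNext]; omega
      refine ⟨-1, by norm_num, Or.inl ?_⟩
      change MapsConeInside (-1) matA _ _ (coneLeft n (coneNext n s 0))
        (coneRight n (coneNext n s 0))
      rw [hf, coneLeft_zero, coneRight_zero]
      exact .of_inOpenCone (matA_eigenvecB_inOpenCone hl (by linarith))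
        (matA_eigenvecB_inOpenCone hl (by linarith))
    · have hf : coneNext n s 1 = s + 1 := by simp [coneNext]; omega
      refine ⟨1, by norm_num, Or.inr ⟨by change s < coneNext n s 1; omega, ?_⟩⟩
      change MapsCone 1 matB _ _ (coneLeft n (coneNext n s 1)) (coneRight n (coneNext n s 1))
      rw [hf]
      rcases h1.eq_or_lt with rfl | h2
      · rw [coneLeft_core, coneRight_core]
        exact .of_inClosedCone
          (matB_eigenvecB_inClosedCone zero_le_one (mul_one _).symm (by linarith) (by linarith))
          (matB_eigenvecB_inClosedCone zero_le_one (mul_one _).symm (by linarith) (by linarith))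
      · rw [coneLeft_of_le (by omega) h2, coneRight_of_le h2, pow_succ]
        exact .of_inClosedCone
          (matB_eigenvecB_inClosedCone zero_le_one (mul_one _).symm (by linarith) (by linarith))
          (matB_eigenvecB_inClosedCone zero_le_one (mul_one _).symm (by linarith) (by linarith))
    · have hf : coneNext n s 2 = 0 := by simp [coneNext]; omega
      refine ⟨1, by norm_num, Or.inl ?_⟩
      change MapsConeInside 1 (matC _) _ _ (coneLeft n (coneNext n s 2))
        (coneRight n (coneNext n s 2))
      rw [hf, coneLeft_zero, coneRight_zero]
      exact .of_inOpenCone (matC_eigenvecB_inOpenCone_base hu one_pos (by linarith))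
        (matC_eigenvecB_inOpenCone_base hu one_pos (by linarith))
  rcases (show s = n + 1 ∨ n + 2 ≤ s by omega) with rfl | h2
  · rw [coneLeft_core, coneRight_core]
    fin_cases i
    · have hf : coneNext n (n + 1) 0 = 0 := by simp [coneNext]
      refine ⟨-1, by norm_num, Or.inl ?_⟩
      change MapsConeInside (-1) matA _ _ (coneLeft n (coneNext n (n + 1) 0))
        (coneRight n (coneNext n (n + 1) 0))
      rw [hf, coneLeft_zero, coneRight_zero]
      exact .of_inOpenCone (matA_eigenvecB_inOpenCone hl (by linarith))
        (matA_eigenvecB_inOpenCone hl (by linarith))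
    · have hf : coneNext n (n + 1) 1 = n + 1 := by simp [coneNext]
      refine ⟨1, by norm_num, Or.inl ?_⟩
      change MapsConeInside 1 matB _ _ (coneLeft n (coneNext n (n + 1) 1))
        (coneRight n (coneNext n (n + 1) 1))
      rw [hf, coneLeft_core, coneRight_core]
      exact .of_inOpenCone (matB_eigenvecB_inOpenCone (by linarith) (by linarith))
        (matB_eigenvecB_inOpenCone (by linarith) (by linarith))
    · have hf : coneNext n (n + 1) 2 = n + 2 := by simp [coneNext]
      refine ⟨1, by norm_num, Or.inr ⟨by change n + 1 < coneNext n (n + 1) 2; omega, ?_⟩⟩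
      change MapsCone 1 (matC _) _ _ (coneLeft n (coneNext n (n + 1) 2))
        (coneRight n (coneNext n (n + 1) 2))
      rw [hf, coneLeft_of_gt le_rfl, coneRight_of_gt le_rfl,
        show 2 * n + 2 - (n + 2) = n by omega]
      refine .of_inClosedCone ?_ ?_ <;>
        rw [matC_mulVec, InClosedCone, planeDet_vec, planeDet_vec] <;> constructor <;> linarith
  · have hk0 := hpow (2 * n + 2 - s)
    have hk1 := hpow1 (2 * n + 2 - s)
    rw [coneLeft_of_gt h2, coneRight_of_gt h2]
    fin_cases i
    · rcases (show s = 2 * n + 2 ∨ s < 2 * n + 2 by omega) with rfl | h3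
      · have hf : coneNext n (2 * n + 2) 0 = 0 := by simp [coneNext]
        refine ⟨-1, by norm_num, Or.inl ?_⟩
        change MapsConeInside (-1) matA _ _ (coneLeft n (coneNext n (2 * n + 2) 0))
          (coneRight n (coneNext n (2 * n + 2) 0))
        rw [hf, coneLeft_zero, coneRight_zero, Nat.sub_self]
        exact .of_inOpenCone (matA_vec_inOpenCone hl (by norm_num))
          (matA_vec_inOpenCone hl (by norm_num))
      · have hf : coneNext n s 0 = s + 1 := by simp [coneNext]; omega
        refine ⟨1, by norm_num, Or.inr ⟨by change s < coneNext n s 0; omega, ?_⟩⟩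
        change MapsCone 1 matA _ _ (coneLeft n (coneNext n s 0)) (coneRight n (coneNext n s 0))
        rw [hf, coneLeft_of_gt (by omega), coneRight_of_gt (by omega),
          show 2 * n + 2 - s = (2 * n + 2 - (s + 1)) + 1 by omega, pow_succ]
        have := hpow (2 * n + 2 - (s + 1))
        refine .of_inClosedCone ?_ ?_ <;>
          rw [matA_mulVec, InClosedCone, planeDet_vec, planeDet_vec] <;> constructor <;> linarith
    · have hf : coneNext n s 1 = 1 := by
        simp [coneNext]; split_ifs <;> omega
      refine ⟨1, by norm_num, Or.inl ?_⟩
      change MapsConeInside 1 matB _ _ (coneLeft n (coneNext n s 1)) (coneRight n (coneNext n s 1))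
      rw [hf, coneLeft_of_le le_rfl hn, coneRight_of_le hn]
      exact .of_inOpenCone (matB_vec_inOpenCone (by linarith))
        (matB_vec_inOpenCone (by linarith))
    · have hf : coneNext n s 2 = 0 := by simp [coneNext]; omega
      refine ⟨1, by norm_num, Or.inl ?_⟩
      change MapsConeInside 1 (matC _) _ _ (coneLeft n (coneNext n s 2))
        (coneRight n (coneNext n s 2))
      rw [hf, coneLeft_zero, coneRight_zero]
      exact .of_inOpenCone
        (matC_vec_inOpenCone_base hu (hpow1 n) (by linarith))
        (matC_vec_inOpenCone_base hu (hpow1 n) (by linarith))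

/-! ### Elliptic products -/

/-- The range of a rank-one idempotent commuting with M would be a real eigenline, which an elliptic
M does not have. -/
lemma idempotent_trivial_of_commute {M P : Matrix (Fin 2) (Fin 2) ℝ} (hdet : M.det = 1)
    (htr : |M.trace| < 2) (hP : P * P = P) (hcomm : M * P = P * M) : P = 0 ∨ P = 1 := by
  rw [det_fin_two] at hdet
  rw [trace_fin_two, abs_lt] at htr
  have e : ∀ {X Y : Matrix (Fin 2) (Fin 2) ℝ}, X = Y → ∀ i j, X i j = Y i j :=
    fun h i j => by rw [h]
  have p00 := e hP 0 0
  have p01 := e hP 0 1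
  have p11 := e hP 1 1
  have c00 := e hcomm 0 0
  have c01 := e hcomm 0 1
  simp only [Matrix.mul_apply, Fin.sum_univ_two] at p00 p01 p11 c00 c01
  have hdisc : (M 0 0 - M 1 1) ^ 2 + 4 * (M 0 1 * M 1 0) < 0 := by nlinarith
  have hb : M 0 1 ≠ 0 := by
    intro h
    rw [h] at hdisc
    nlinarith [sq_nonneg (M 0 0 - M 1 1)]
  by_cases hq : P 0 1 = 0
  · have hr : P 1 0 = 0 := by
      rw [hq] at c00
      have : M 0 1 * P 1 0 = 0 := by linarith
      exact (mul_eq_zero.1 this).resolve_left hb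
    have hs : P 1 1 = P 0 0 := by
      rw [hq] at c01
      have : M 0 1 * (P 1 1 - P 0 0) = 0 := by linarith
      linarith [(mul_eq_zero.1 this).resolve_left hb]
    have hp : P 0 0 * (P 0 0 - 1) = 0 := by
      rw [hq] at p00; linarith
    rcases mul_eq_zero.1 hp with h | h
    · left
      ext i j
      fin_cases i <;> fin_cases j <;> simp [hq, hr, hs, h]
    · right
      have h1 : P 0 0 = 1 := by linarith
      ext i j
      fin_cases i <;> fin_cases j <;> simp [hq, hr, hs, h1]
  · exfalso
    have hs : P 1 1 = 1 - P 0 0 := by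
      have : P 0 1 * (P 0 0 + P 1 1 - 1) = 0 := by linarith
      linarith [(mul_eq_zero.1 this).resolve_left hq]
    rw [hs] at c01
    have h1 : (M 0 0 - M 1 1) * P 0 1 = M 0 1 * (2 * P 0 0 - 1) := by linarith
    have h2 : M 0 1 * P 1 0 = P 0 1 * M 1 0 := by linarith
    -- The left side is positive, while the last factor is the discriminant (tr M)² - 4 < 0.
    have h3 : M 0 1 ^ 2 = P 0 1 ^ 2 * ((M 0 0 - M 1 1) ^ 2 + 4 * (M 0 1 * M 1 0)) := by
      linear_combination -4 * M 0 1 ^ 2 * p00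
        - ((M 0 0 - M 1 1) * P 0 1 + M 0 1 * (2 * P 0 0 - 1)) * h1
        + 4 * M 0 1 * P 0 1 * h2
    have h4 : 0 < P 0 1 ^ 2 := by positivity
    nlinarith [sq_nonneg (M 0 1)]

/-- All entries of M n would tend to 0, against determinant one. -/
lemma not_forall_contracting (M : ℕ → SL(2, ℝ)) {K l : ℝ} (hl : 0 < l) (hl1 : l < 1)
    (h : ∀ (n : ℕ) (v : Fin 2 → ℝ),
      ‖(M n : Matrix (Fin 2) (Fin 2) ℝ) *ᵥ v‖ ≤ K * l ^ n * ‖v‖) : False := by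
  have hent : ∀ n i j, |M n i j| ≤ K * l ^ n := by
    intro n i j
    have h1 := h n (Pi.single j 1)
    rw [mulVec_single_one] at h1
    have h2 := norm_le_pi_norm ((M n : Matrix (Fin 2) (Fin 2) ℝ).col j) i
    rw [Real.norm_eq_abs] at h2
    refine (h2.trans h1).trans (le_of_eq ?_)
    rw [Pi.norm_single]; simp
  have hlim : Tendsto (fun n : ℕ => K * l ^ n) atTop (𝓝 (K * 0)) :=
    (tendsto_pow_atTop_nhds_zero_of_lt_one hl.le hl1).const_mul K
  rw [mul_zero] at hlim
  obtain ⟨n, hn⟩ := (hlim.eventually_lt_const (by norm_num : (0 : ℝ) < 1 / 2)).exists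
  have hb : ∀ i j, |M n i j| ≤ 1 / 2 := fun i j => (hent n i j).trans hn.le
  have hd := sl_det_entries (M n)
  have a1 : |M n 0 0 * M n 1 1| ≤ 1 / 2 * (1 / 2) := by
    rw [abs_mul]; exact mul_le_mul (hb 0 0) (hb 1 1) (abs_nonneg _) (by norm_num)
  have a2 : |M n 0 1 * M n 1 0| ≤ 1 / 2 * (1 / 2) := by
    rw [abs_mul]; exact mul_le_mul (hb 0 1) (hb 1 0) (abs_nonneg _) (by norm_num)
  linarith [(abs_le.1 a1).2, (abs_le.1 a2).1]

lemma exists_periodic_point {N : ℕ} (A : Fin N → SL(2, ℝ)) {w : List (Fin N)} (hw : w ≠ []) :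
    ∃ x : ℤ → Fin N, shiftBy w.length x = x ∧
      forwardProduct A x w.length = (w.map A).prod := by
  have hk : 0 < w.length := List.length_pos_iff.2 hw
  set k := w.length with hkdef
  -- The forward product puts later letters on the left, so the word is read backwards along the
  -- orbit.
  set x : ℤ → Fin N := fun j => w[k - 1 - (j % (k : ℤ)).toNat]'(by omega) with hx
  have hprod : ∀ n ≤ k, forwardProduct A x n = ((w.drop (k - n)).map A).prod := by
    intro n hn
    induction n with
    | zero => simp [forwardProduct, hkdef]
    | succ n ih =>
      have h1 : x n = w[k - (n + 1)]'(by omega) := by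
        simp only [hx]
        congr 1
        rw [Int.emod_eq_of_lt (by omega) (by omega)]
        omega
      rw [forwardProduct, ih (by omega), h1,
        List.drop_eq_getElem_cons (show k - (n + 1) < w.length by omega), List.map_cons,
        List.prod_cons, show k - (n + 1) + 1 = k - n by omega]
  refine ⟨x, ?_, by rw [hprod k le_rfl]; simp⟩
  funext j
  simp [shiftBy, hx]

/-- Uniformly hyperbolic cocycles have no elliptic products. -/
theorem two_le_abs_trace_of_mem_hyperbolicLocus {N : ℕ} {A : Fin N → SL(2, ℝ)}
    (hA : A ∈ hyperbolicLocus N) (w : List (Fin N)) :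
    2 ≤ |Matrix.trace ((w.map A).prod : Matrix (Fin 2) (Fin 2) ℝ)| := by
  by_contra! hlt
  rcases eq_or_ne w [] with rfl | hw
  · simp at hlt
  obtain ⟨P, -, hPP, hinv, K, l, -, hl, hl1, hs, hu⟩ := hA
  obtain ⟨x, hx, hprod⟩ := exists_periodic_point A hw
  have hcomm : ∀ n : ℕ, (forwardProduct A x n : Matrix (Fin 2) (Fin 2) ℝ) * P x
      = P (shiftBy n x) * forwardProduct A x n := by
    intro n
    induction n with
    | zero =>
      have : (forwardProduct A x 0 : Matrix (Fin 2) (Fin 2) ℝ) = 1 := rfl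
      rw [this, one_mul, mul_one]
      exact congrArg P (shiftBy_zero x).symm
    | succ n ih =>
      have h1 : (forwardProduct A x (n + 1) : Matrix (Fin 2) (Fin 2) ℝ)
          = A (x n) * forwardProduct A x n :=
        Matrix.SpecialLinearGroup.coe_mul (A (x n)) (forwardProduct A x n)
      have h2 := hinv (shiftBy n x)
      have h3 : (fun m => shiftBy (n : ℤ) x (m + 1)) = shiftBy ((n + 1 : ℕ) : ℤ) x := by
        funext m; simp [shiftBy, add_comm, add_left_comm]
      have h4 : shiftBy (n : ℤ) x 0 = x n := by simp [shiftBy]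
      rw [h3, h4] at h2
      rw [h1, mul_assoc, ih, ← mul_assoc, h2, mul_assoc]
  have hc := hcomm w.length
  rw [hx, hprod] at hc
  -- A trivial projection makes the whole plane stable or unstable, so one of the two families of
  -- products contracts every vector.
  rcases idempotent_trivial_of_commute (Matrix.SpecialLinearGroup.det_coe _) hlt (hPP x) hc with
    h | h
  · refine not_forall_contracting (backwardProduct A x) (K := K) hl hl1 fun n v => hu x n v ?_
    rw [h, zero_mulVec]
  · refine not_forall_contracting (forwardProduct A x) (K := K) hl hl1 fun n v => hs x n v ?_
    rw [h, one_mulVec]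

lemma continuous_trace_word {N : ℕ} (w : List (Fin N)) :
    Continuous fun A : Fin N → SL(2, ℝ) =>
      Matrix.trace ((w.map A).prod : Matrix (Fin 2) (Fin 2) ℝ) := by
  have h : Continuous fun A : Fin N → SL(2, ℝ) => (w.map A).prod :=
    continuous_list_prod w fun i _ => continuous_apply i
  exact (continuous_subtype_val.comp h).matrix_trace

/-- The trace of a product has a constant sign on each hyperbolic component. -/
lemma trace_word_pos_of_mem_component {N : ℕ} {A A' : Fin N → SL(2, ℝ)}
    (hA' : A' ∈ connectedComponentIn (hyperbolicLocus N) A) (w : List (Fin N))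
    (h : 0 < Matrix.trace ((w.map A').prod : Matrix (Fin 2) (Fin 2) ℝ)) :
    0 < Matrix.trace ((w.map A).prod : Matrix (Fin 2) (Fin 2) ℝ) := by
  have hA : A ∈ hyperbolicLocus N := by
    by_contra hn
    rw [connectedComponentIn_eq_empty hn] at hA'
    exact hA'
  by_contra! hle
  obtain ⟨D, hD, hD0⟩ := isPreconnected_connectedComponentIn.intermediate_value
    (mem_connectedComponentIn hA) hA' (continuous_trace_word w).continuousOn ⟨hle, h.le⟩
  have := two_le_abs_trace_of_mem_hyperbolicLocus (connectedComponentIn_subset _ _ hD) w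
  simp only at hD0
  rw [hD0, abs_zero] at this
  norm_num at this

/-! ### The path -/

/-- The word whose product is `Aⁿ C Bⁿ`. -/
def heteroclinicWord (n : ℕ) : List (Fin 3) :=
  List.replicate n 0 ++ 2 :: List.replicate n 1

/-- The factor 7 · 7 by which B changes Y / X is undone by A on slopes, except in the term t X,
which keeps the factor 49. -/
lemma matA_mul_matC_mul_matB (t : ℝ) : matA * matC t * matB = matC (49 * t) := by
  ext i j
  rw [Matrix.SpecialLinearGroup.coe_mul, Matrix.SpecialLinearGroup.coe_mul]
  fin_cases i <;> fin_cases j <;>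
    simp [matA, matB, matC, Matrix.mul_apply, Fin.sum_univ_two] <;> ring

lemma prod_heteroclinicWord (n : ℕ) (t : ℝ) :
    ((heteroclinicWord n).map ![matA, matB, matC t]).prod = matC (49 ^ n * t) := by
  have h : ((heteroclinicWord n).map ![matA, matB, matC t]).prod
      = matA ^ n * matC t * matB ^ n := by
    simp [heteroclinicWord, mul_assoc]
  rw [h]
  induction n with
  | zero => simp
  | succ n ih =>
    have ih := ih (by simp [heteroclinicWord, mul_assoc])
    calc _ = matA * (matA ^ n * matC t * matB ^ n) * matB := by
          rw [pow_succ', pow_succ]; simp only [mul_assoc]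
      _ = _ := by rw [ih, matA_mul_matC_mul_matB]; congr 1; ring

lemma trace_heteroclinicWord (n : ℕ) (t : ℝ) :
    Matrix.trace (((heteroclinicWord n).map ![matA, matB, matC t]).prod :
      Matrix (Fin 2) (Fin 2) ℝ) = 15 / 11 + (15 - 7 * (49 ^ n * t)) / 16 := by
  rw [prod_heteroclinicWord]
  exact trace_fin_two_of _ _ _ _

lemma continuous_path : Continuous fun t : ℝ => (![matA, matB, matC t] : Fin 3 → SL(2, ℝ)) := by
  have hC : Continuous matC := by
    refine Continuous.subtype_mk (continuous_matrix fun i j => ?_) _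
    fin_cases i <;> fin_cases j <;> simp <;> fun_prop
  refine continuous_pi fun i => ?_
  fin_cases i <;> simp <;> fun_prop

/-- 405/77 is the zero of the trace 15/11 + (15 - 7 t)/16, so Aⁿ C Bⁿ has trace 0 here. -/
lemma path_mem_ellipticLocus (n : ℕ) :
    ![matA, matB, matC (405 / 77 * (1 / 49) ^ n)] ∈ ellipticLocus 3 := by
  refine ⟨heteroclinicWord n, ?_⟩
  rw [trace_heteroclinicWord]
  have : (49 : ℝ) ^ n * (405 / 77 * (1 / 49) ^ n) = 405 / 77 := by
    rw [mul_left_comm, ← mul_pow]; norm_num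
  rw [this]; norm_num

lemma heteroclinicConnection_matC_zero : HeteroclinicConnection matA matB (matC 0) := by
  refine ⟨![15, -7], spansUnstable_matB, ?_⟩
  have h : (matC 0 : Matrix (Fin 2) (Fin 2) ℝ) *ᵥ ![15, -7] = ![16, 0] := by
    ext i; fin_cases i
    · rw [Fin.zero_eta, mulVec_zero_apply]; simp [matC]; norm_num
    · rw [Fin.mk_one, mulVec_one_apply]; simp [matC]; norm_num
  rw [h]
  refine spansStable_of_entries (by norm_num) (1 / 7) (by norm_num [abs_lt]) ?_ ?_ <;>
    rw [coe_matA] <;> norm_num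

lemma tendsto_const_mul_geometric (c : ℝ) :
    Tendsto (fun i : ℕ => c * (1 / 49 : ℝ) ^ i) atTop (𝓝 0) := by
  simpa using (tendsto_pow_atTop_nhds_zero_of_lt_one (r := (1 / 49 : ℝ)) (by norm_num)
    (by norm_num)).const_mul c

/-- The parameters t < 0 give the closure; elliptic triples with t > 0 arbitrarily small exclude the
interior. -/
lemma path_mem_frontier :
    ![matA, matB, matC 0] ∈
      frontier (connectedComponentIn (hyperbolicLocus 3) ![matA, matB, -(matA * matB)]) := by
  constructor
  · refine mem_closure_of_tendsto (f := fun i : ℕ => ![matA, matB, matC (-1 * (1 / 49) ^ i)])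
      (b := atTop) ((continuous_path.tendsto 0).comp (tendsto_const_mul_geometric (-1)))
      (Eventually.of_forall fun i => matC_mem_component ?_)
    have : (0 : ℝ) < (1 / 49) ^ i := by positivity
    linarith
  · intro h
    have hlim := (continuous_path.tendsto 0).comp (tendsto_const_mul_geometric (405 / 77))
    obtain ⟨i, hi⟩ := (hlim.eventually (isOpen_interior.mem_nhds h)).exists
    obtain ⟨w, hw⟩ := path_mem_ellipticLocus i
    exact absurd (two_le_abs_trace_of_mem_hyperbolicLocus
      (connectedComponentIn_subset _ _ (interior_subset hi)) w) (not_le.2 hw)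

/-- The hyperbolic component of the `i`-th hyperbolic triple after the heteroclinic connection. -/
def componentAfter (i : ℕ) : Set (Fin 3 → SL(2, ℝ)) :=
  connectedComponentIn (hyperbolicLocus 3) ![matA, matB, matC ((1 / 49) ^ (i + 1) / 4)]

lemma path_mem_hyperbolicLocus (i : ℕ) :
    ![matA, matB, matC ((1 / 49) ^ (i + 1) / 4)] ∈ hyperbolicLocus 3 :=
  uniformlyHyperbolic_matC (by omega)

lemma path_mem_componentAfter (i : ℕ) :
    ![matA, matB, matC ((1 / 49) ^ (i + 1) / 4)] ∈ componentAfter i :=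
  mem_connectedComponentIn (path_mem_hyperbolicLocus i)

lemma isHyperbolicComponent_componentAfter (i : ℕ) : IsHyperbolicComponent (componentAfter i) :=
  ⟨_, path_mem_hyperbolicLocus i, rfl⟩

lemma injective_componentAfter : Function.Injective componentAfter := by
  have key : ∀ i j, i < j → componentAfter i ≠ componentAfter j := by
    intro i j hij h
    have hmem := path_mem_componentAfter j
    rw [← h] at hmem
    -- The product for n = j + 1 is C(1/4) at the j-th point and C(49^(j-i)/4) at the i-th. The zero
    -- 405/77 of the trace lies between 1/4 and 49/4, so the signs differ.
    have hpos := trace_word_pos_of_mem_component hmem (heteroclinicWord (j + 1)) (by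
      rw [trace_heteroclinicWord]
      have : (49 : ℝ) ^ (j + 1) * ((1 / 49) ^ (j + 1) / 4) = 1 / 4 := by
        rw [mul_div_assoc', ← mul_pow]; norm_num
      rw [this]; norm_num)
    rw [trace_heteroclinicWord] at hpos
    obtain ⟨k, rfl⟩ := Nat.exists_eq_add_of_lt hij
    have h1 : (49 : ℝ) ^ (i + k + 1 + 1) * ((1 / 49) ^ (i + 1) / 4) = 49 * 49 ^ k / 4 := by
      rw [show i + k + 1 + 1 = (i + 1) + (k + 1) by ring, pow_add, mul_div_assoc',
        mul_right_comm, ← mul_pow]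
      norm_num
      ring
    have h2 : (1 : ℝ) ≤ 49 ^ k := one_le_pow₀ (by norm_num)
    rw [h1] at hpos
    linarith
  intro i j h
  rcases lt_trichotomy i j with hij | hij | hij
  · exact absurd h (key i j hij)
  · exact hij
  · exact absurd h.symm (key j i hij)

lemma tendsto_parameterAfter : Tendsto (fun i : ℕ => (1 / 49 : ℝ) ^ (i + 1) / 4) atTop (𝓝 0) := by
  refine (tendsto_const_mul_geometric (1 / 196)).congr fun i => ?_
  rw [pow_succ]; ring

theorem proposition4p15 :
    ∃ H : Set (Fin 3 → SL(2, ℝ)), IsHyperbolicComponent H ∧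
      (∃ A₀ B₀ : SL(2, ℝ), InPositiveFreeComponent A₀ B₀ ∧ ![A₀, B₀, -(A₀ * B₀)] ∈ H) ∧
      ∃ (A B : SL(2, ℝ)) (C : ℝ → SL(2, ℝ)),
        (∀ i j : Fin 2, ContDiff ℝ ∞ (fun t : ℝ => C t i j)) ∧
        (∀ t : ℝ, t < 0 → ![A, B, C t] ∈ H) ∧
        (HeteroclinicConnection A B (C 0) ∧ ![A, B, C 0] ∈ frontier H) ∧
        (∃ (K : ℕ → Set (Fin 3 → SL(2, ℝ))) (t : ℕ → ℝ),
          (∀ i, IsHyperbolicComponent (K i)) ∧ Function.Injective K ∧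
          (∀ i, 0 < t i) ∧ Tendsto t atTop (𝓝 0) ∧ ∀ i, ![A, B, C (t i)] ∈ K i) ∧
        (∃ s : ℕ → ℝ, (∀ i, 0 < s i) ∧ Tendsto s atTop (𝓝 0) ∧
          ∀ i, ![A, B, C (s i)] ∈ ellipticLocus 3) ∧
        (∀ V ∈ 𝓝 (![A, B, C 0] : Fin 3 → SL(2, ℝ)),
          {K : Set (Fin 3 → SL(2, ℝ)) |
            IsHyperbolicComponent K ∧ (K ∩ V).Nonempty}.Infinite) := by
  refine ⟨connectedComponentIn (hyperbolicLocus 3) ![matA, matB, -(matA * matB)],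
    ⟨_, neg_matA_mul_matB_mem_hyperbolicLocus, rfl⟩,
    ⟨matA, matB, inPositiveFreeComponent_matA_matB,
      mem_connectedComponentIn neg_matA_mul_matB_mem_hyperbolicLocus⟩,
    matA, matB, matC, ?_, fun t ht => matC_mem_component ht,
    ⟨heteroclinicConnection_matC_zero, path_mem_frontier⟩,
    ⟨componentAfter, fun i => (1 / 49) ^ (i + 1) / 4, isHyperbolicComponent_componentAfter,
      injective_componentAfter, fun i => by positivity, tendsto_parameterAfter,
      path_mem_componentAfter⟩,
    ⟨fun i => 405 / 77 * (1 / 49) ^ i, fun i => by positivity, tendsto_const_mul_geometric _,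
      path_mem_ellipticLocus⟩, ?_⟩
  · intro i j
    fin_cases i <;> fin_cases j <;> simp [matC] <;> fun_prop
  · intro V hV
    have hlim := (continuous_path.tendsto 0).comp tendsto_parameterAfter
    obtain ⟨n, hn⟩ := eventually_atTop.1 (hlim.eventually hV)
    refine ((Set.Ici_infinite n).image injective_componentAfter.injOn).mono ?_
    rintro _ ⟨i, hi, rfl⟩
    exact ⟨isHyperbolicComponent_componentAfter i, _, path_mem_componentAfter i, hn i hi⟩
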